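/- Let $R$ be a commutative Noetherian local ring and let $C$ and $M$ be finitely generated $R$-modules. Assume that $C$ is semidualizing, that is, the natural map $R\to\operatorname{Hom}_R(C,C)$ is bijective and $\operatorname{Ext}^i_R(C,C)=0$ for all $i\ge 1$. Assume that $M$ is nonzero and strongly-rigid, that is, every finitely generated $R$-module $N$ with $\operatorname{Tor}_n^R(M,N)=0$ for some $n\ge 1$ has finite projective dimension. Let $C\text{-}\operatorname{pd}(M)$ be the infimum of the integers $n\ge 0$ for which there is an exact sequence $$0\to C^{b_n}\to C^{b_{n-1}}\to\cdots\to C^{b_0}\to M\to 0$$ with positive integers $b_0,\dots,b_n$, and let $C\text{-}\operatorname{id}(M)$ be the infimum of the integers $n\ge 0$ for which there is an exact sequence $$0\to M\to \operatorname{Hom}_R(C,I^0)\to \operatorname{Hom}_R(C,I^1)\to\cdots\to \operatorname{Hom}_R(C,I^n)\to 0$$ with injective $R$-modules $I^0,\dots,I^n$ (the infimum of the empty set being $\infty$). If $C\text{-}\operatorname{pd}(M)<\infty$ or $C\text{-}\operatorname{id}(M)<\infty$, then $R$ is a regular local ring. -/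

import Mathlib

open CategoryTheory

universe u

noncomputable section

/-- A module `C` over `R` is semidualizing if the natural (homothety) map `R → Hom_R(C, C)`,
`r ↦ (c ↦ r • c)`, is bijective and `Ext^i_R(C, C) = 0` for all `i ≥ 1`. (Finite generation
is a separate hypothesis wherever the notion is used.) -/
structure IsSemidualizing (R : Type u) [CommRing R] (C : Type u) [AddCommGroup C] [Module R C] :
    Prop where
  bijective_homothety : Function.Bijective (LinearMap.lsmul R C)
  ext_eq_zero : ∀ i : ℕ, 1 ≤ i →
    Subsingleton (Abelian.Ext (ModuleCat.of R C) (ModuleCat.of R C) i)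

/-- `M` is strongly-rigid if every finitely generated module `N` such that
`Tor_n^R(M, N) = 0` for some `n ≥ 1` has finite projective dimension. -/
def IsStronglyRigid (R : Type u) [CommRing R] (M : Type u) [AddCommGroup M] [Module R M] : Prop :=
  ∀ (N : Type u) [AddCommGroup N] [Module R N] [Module.Finite R N] (n : ℕ), 1 ≤ n →
    Limits.IsZero (((Tor (ModuleCat.{u} R) n).obj (ModuleCat.of R M)).obj (ModuleCat.of R N)) →
    projectiveDimension (ModuleCat.of R N) < ⊤

/-- There is an exact sequence `0 → C^{b_n} → ⋯ → C^{b_1} → C^{b_0} → M → 0` with all of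
`b_0, …, b_n` positive. The sequence is continued by `C^{b_i} = 0` for `i > n`, so that exactness
at `C^{b_n}` is the injectivity of the map out of `C^{b_n}`. -/
def HasCProjectiveResolution (R : Type u) [CommRing R] (C : Type u) [AddCommGroup C] [Module R C]
    (M : Type u) [AddCommGroup M] [Module R M] (n : ℕ) : Prop :=
  ∃ (b : ℕ → ℕ) (d : ∀ i : ℕ, (Fin (b (i + 1)) → C) →ₗ[R] (Fin (b i) → C))
    (ε : (Fin (b 0) → C) →ₗ[R] M),
    (∀ i : ℕ, i ≤ n → 0 < b i) ∧ (∀ i : ℕ, n < i → b i = 0) ∧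
    Function.Surjective ε ∧ Function.Exact (d 0) ε ∧
    ∀ i : ℕ, Function.Exact (d (i + 1)) (d i)

/-- There is an exact sequence
`0 → M → Hom_R(C, I^0) → Hom_R(C, I^1) → ⋯ → Hom_R(C, I^n) → 0` with all `I^i` injective
`R`-modules. The sequence is continued by `I^i = 0` for `i > n`, so that exactness
at `Hom_R(C, I^n)` is the surjectivity of the map into it. -/
def HasCInjectiveResolution (R : Type u) [CommRing R] (C : Type u) [AddCommGroup C] [Module R C]
    (M : Type u) [AddCommGroup M] [Module R M] (n : ℕ) : Prop :=
  ∃ (I : ℕ → ModuleCat.{u} R) (η : M →ₗ[R] (C →ₗ[R] I 0))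
    (d : ∀ i : ℕ, (C →ₗ[R] I i) →ₗ[R] (C →ₗ[R] I (i + 1))),
    (∀ i : ℕ, Module.Injective R (I i)) ∧ (∀ i : ℕ, n < i → Subsingleton (I i)) ∧
    Function.Injective η ∧ Function.Exact η (d 0) ∧
    ∀ i : ℕ, Function.Exact (d i) (d (i + 1))

/-- The `C`-projective dimension of `M`: the infimum of the lengths of the resolutions of `M`
by finite direct sums of copies of `C` (it is `⊤` if there is none). -/
def cProjectiveDimension (R : Type u) [CommRing R] (C : Type u) [AddCommGroup C] [Module R C]
    (M : Type u) [AddCommGroup M] [Module R M] : ℕ∞ :=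
  ⨅ (n : ℕ) (_ : HasCProjectiveResolution R C M n), (n : ℕ∞)

/-- The `C`-injective dimension of `M`: the infimum of the lengths of the coresolutions of `M`
by modules `Hom_R(C, I)` with `I` injective (it is `⊤` if there is none). -/
def cInjectiveDimension (R : Type u) [CommRing R] (C : Type u) [AddCommGroup C] [Module R C]
    (M : Type u) [AddCommGroup M] [Module R M] : ℕ∞ :=
  ⨅ (n : ℕ) (_ : HasCInjectiveResolution R C M n), (n : ℕ∞)

end

/-! The module C enters only through one consequence: `ExtZero R M M j` for all large j. For
C-projective resolutions this is dimension shifting from the vanishing of Ext(C, C). For C-injective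
ones, Ext(Hom(C, I), Hom(C, I')) must vanish in positive degrees. Since I' is injective, this
reduces to Ext(C, Hom(Hom(C, I), I')) (`ExtZero.hom_swap`), which vanishes because Tor(C, Hom(C, I))
is governed by Ext(C, C) through the map K ⊗ Hom(C, I) → Hom(Hom(K, C), I) (`ExtZero.hom_hom`).

The heart is `IsStronglyRigid.finitePd_self`: strong rigidity and the vanishing of high Ext(M, M)
force pd M < ∞. Iterated cones of multiplication by generators of the maximal ideal 𝔪 replace M by
Y, with Ext(Y, M) still zero in high degrees, with Ext(Y, -) killed by powers of the generators in
positive degrees, and with pd M < ∞ as soon as pd Y < ∞. Let F be a free resolution of Y, F* its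
dual, and N the cokernel of a differential of F* far out. Vanishing of Ext(Y, M) says that Hom(F, M)
= M ⊗ F* is exact far out, so Tor_1(M, N) = 0 and rigidity gives pd N < ∞. The cohomology of F* is
killed by powers of 𝔪, so its Ext into R vanishes below t = depth R; hence Ext^j(N, R) = 0 for 1 ≤ j
≤ t. By Auslander–Buchsbaum pd N ≤ t, and the top Ext(N, R) of a nonprojective module of finite
projective dimension is nonzero, so N is projective. Dualizing back, a syzygy of Y is projective.

Once pd M < ∞, M is Tor-independent of high syzygies, so rigidity gives every finitely generated
module, in particular the residue field, finite projective dimension. Serre's theorem, proved by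
cutting down by a regular element of 𝔪 outside 𝔪², ends the proof. -/

open Abelian

/-! ### Vanishing and annihilation of Ext along short exact sequences -/

section ExtVanishing

variable (R : Type u) [CommRing R]

/-- `Ext^i_R(X, V) = 0`. -/
def ExtZero (X V : Type u) [AddCommGroup X] [Module R X] [AddCommGroup V] [Module R V]
    (i : ℕ) : Prop :=
  ∀ e : Ext (ModuleCat.of R X) (ModuleCat.of R V) i, e = 0

/-- `c` annihilates `Ext^i_R(X, V)`. -/
def ExtKill (c : R) (X V : Type u) [AddCommGroup X] [Module R X] [AddCommGroup V] [Module R V]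
    (i : ℕ) : Prop :=
  ∀ e : Ext (ModuleCat.of R X) (ModuleCat.of R V) i, c • e = 0

variable {R}
variable {X Y Z V : Type u} [AddCommGroup X] [Module R X] [AddCommGroup Y] [Module R Y]
  [AddCommGroup Z] [Module R Z] [AddCommGroup V] [Module R V]

/-- The short complex attached to an exact pair of linear maps. -/
abbrev exactComplex (f : X →ₗ[R] Y) (g : Y →ₗ[R] Z) (h : Function.Exact f g) :
    ShortComplex (ModuleCat.{u} R) :=
  ShortComplex.mk (ModuleCat.ofHom f) (ModuleCat.ofHom g)
    (by rw [← ModuleCat.ofHom_comp, h.linearMap_comp_eq_zero]; rfl)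

lemma exactComplex_shortExact {f : X →ₗ[R] Y} {g : Y →ₗ[R] Z} (h : Function.Exact f g)
    (hf : Function.Injective f) (hg : Function.Surjective g) :
    (exactComplex f g h).ShortExact :=
  ModuleCat.shortComplex_shortExact _ h hf hg

lemma extZero_iff_subsingleton {i : ℕ} : ExtZero R X V i ↔
    Subsingleton (Ext (ModuleCat.of R X) (ModuleCat.of R V) i) :=
  ⟨fun h => subsingleton_of_forall_eq 0 h, fun _ _ => Subsingleton.elim _ _⟩

lemma extZero_zero_iff : ExtZero R X V 0 ↔ ∀ f : X →ₗ[R] V, f = 0 := by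
  refine ⟨fun h f => ?_, fun h e => ?_⟩
  · have := h (Ext.mk₀ (ModuleCat.ofHom f))
    rw [Ext.mk₀_eq_zero_iff] at this
    exact congrArg ModuleCat.Hom.hom this
  · obtain ⟨f, rfl⟩ := (Ext.mk₀_bijective _ _).2 e
    rw [Ext.mk₀_eq_zero_iff]
    ext1
    exact h _

lemma ExtZero.of_projective [Module.Projective R X] {i : ℕ} (hi : 1 ≤ i) : ExtZero R X V i := by
  obtain ⟨i, rfl⟩ := Nat.exists_eq_add_of_le' hi
  exact fun e => Ext.eq_zero_of_projective e

lemma ExtZero.of_injective [h : Module.Injective R V] {i : ℕ} (hi : 1 ≤ i) :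
    ExtZero R X V i := by
  obtain ⟨i, rfl⟩ := Nat.exists_eq_add_of_le' hi
  rw [Module.injective_iff_injective_object] at h
  exact fun e => Ext.eq_zero_of_injective e

lemma ExtZero.of_subsingleton_left [Subsingleton X] {i : ℕ} : ExtZero R X V i := by
  intro e
  rw [← e.mk₀_id_comp, (ModuleCat.isZero_of_subsingleton (ModuleCat.of R X)).eq_of_src (𝟙 _) 0,
    Ext.mk₀_zero, Ext.zero_comp]

/-- If the identity of `X` multiplied by `c` factors through `Y`, then `c` annihilates what
vanishes on `Y`. -/
lemma ExtZero.kill_of_factor {i : ℕ} (h : ExtZero R Y V i) (a : X →ₗ[R] Y) (b : Y →ₗ[R] X)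
    (c : R) (hc : ∀ x, b (a x) = c • x) : ExtKill R c X V i := by
  intro e
  have h1 : ModuleCat.ofHom a ≫ ModuleCat.ofHom b = c • 𝟙 (ModuleCat.of R X) := by
    ext x
    exact hc x
  have h2 : c • e = (Ext.mk₀ (c • 𝟙 (ModuleCat.of R X))).comp e (zero_add i) := by
    rw [Ext.mk₀_smul, Ext.smul_comp, Ext.mk₀_id_comp]
  rw [h2, ← h1, ← Ext.mk₀_comp_mk₀_assoc, h ((Ext.mk₀ (ModuleCat.ofHom b)).comp e (zero_add i)),
    Ext.comp_zero]

lemma ExtZero.of_factor_left {i : ℕ} (h : ExtZero R Y V i) (a : X →ₗ[R] Y) (b : Y →ₗ[R] X)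
    (hc : ∀ x, b (a x) = x) : ExtZero R X V i := fun e => by
  simpa using h.kill_of_factor a b 1 (by simpa using hc) e

lemma ExtZero.of_factor_right {i : ℕ} (h : ExtZero R V Y i) (a : X →ₗ[R] Y) (b : Y →ₗ[R] X)
    (hc : ∀ x, b (a x) = x) : ExtZero R V X i := by
  intro e
  have h1 : ModuleCat.ofHom a ≫ ModuleCat.ofHom b = 𝟙 (ModuleCat.of R X) := by
    ext x
    exact hc x
  rw [← e.comp_mk₀_id, ← h1, ← Ext.mk₀_comp_mk₀,
    ← Ext.comp_assoc_of_third_deg_zero, h (e.comp _ _), Ext.zero_comp]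

lemma ExtZero.congr_left {i : ℕ} (h : ExtZero R Y V i) (e : X ≃ₗ[R] Y) : ExtZero R X V i :=
  h.of_factor_left e.toLinearMap e.symm.toLinearMap (by simp)

lemma ExtZero.congr_right {i : ℕ} (h : ExtZero R V Y i) (e : X ≃ₗ[R] Y) : ExtZero R V X i :=
  h.of_factor_right e.toLinearMap e.symm.toLinearMap (by simp)

lemma ExtZero.pi_right {i : ℕ} (h : ExtZero R X V i) (b : ℕ) : ExtZero R X (Fin b → V) i := by
  intro e
  have h1 : 𝟙 (ModuleCat.of R (Fin b → V)) = ∑ j : Fin b,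
      (ModuleCat.ofHom (LinearMap.proj (R := R) (φ := fun _ : Fin b => V) j)) ≫
        ModuleCat.ofHom (LinearMap.single R (fun _ : Fin b => V) j) := by
    ext v
    simp [ModuleCat.hom_sum]
  rw [← e.comp_mk₀_id, h1, Ext.mk₀_sum, Ext.comp_sum]
  refine Finset.sum_eq_zero fun j _ => ?_
  rw [← Ext.mk₀_comp_mk₀, ← Ext.comp_assoc_of_third_deg_zero, h (e.comp _ _), Ext.zero_comp]

lemma ExtZero.pi_left {i : ℕ} (h : ExtZero R V X i) (b : ℕ) : ExtZero R (Fin b → V) X i := by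
  intro e
  have h1 : 𝟙 (ModuleCat.of R (Fin b → V)) = ∑ j : Fin b,
      (ModuleCat.ofHom (LinearMap.proj (R := R) (φ := fun _ : Fin b => V) j)) ≫
        ModuleCat.ofHom (LinearMap.single R (fun _ : Fin b => V) j) := by
    ext v
    simp [ModuleCat.hom_sum]
  rw [← e.mk₀_id_comp, h1, Ext.mk₀_sum, Ext.sum_comp]
  refine Finset.sum_eq_zero fun j _ => ?_
  rw [← Ext.mk₀_comp_mk₀_assoc, h ((Ext.mk₀ _).comp e _), Ext.comp_zero]

section LongExact

variable {f : X →ₗ[R] Y} {g : Y →ₗ[R] Z} (h : Function.Exact f g)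
    (hf : Function.Injective f) (hg : Function.Surjective g)
include h hf hg

lemma ExtZero.contra_mid {i : ℕ} (h1 : ExtZero R X V i) (h3 : ExtZero R Z V i) :
    ExtZero R Y V i := fun e => by
  obtain ⟨x, rfl⟩ := Ext.contravariant_sequence_exact₂ (exactComplex_shortExact h hf hg) _ e
    (h1 _)
  rw [h3 x, Ext.comp_zero]

lemma ExtZero.contra_left {i : ℕ} (h2 : ExtZero R Y V i) (h3 : ExtZero R Z V (i + 1)) :
    ExtZero R X V i := fun e => by
  obtain ⟨x, rfl⟩ := Ext.contravariant_sequence_exact₁ (exactComplex_shortExact h hf hg) _ e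
    (add_comm 1 i) (h3 _)
  rw [h2 x, Ext.comp_zero]

lemma ExtZero.contra_right {i : ℕ} (h1 : ExtZero R X V i) (h2 : ExtZero R Y V (i + 1)) :
    ExtZero R Z V (i + 1) := fun e => by
  obtain ⟨x, rfl⟩ := Ext.contravariant_sequence_exact₃ (exactComplex_shortExact h hf hg) _ e
    (h2 _) (add_comm 1 i)
  rw [h1 x, Ext.comp_zero]

lemma ExtZero.cov_right {i : ℕ} (h2 : ExtZero R V Y i) (h1 : ExtZero R V X (i + 1)) :
    ExtZero R V Z i := fun e => by
  obtain ⟨x, rfl⟩ := Ext.covariant_sequence_exact₃ _ (exactComplex_shortExact h hf hg) e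
    rfl (h1 _)
  rw [h2 x, Ext.zero_comp]

lemma ExtZero.cov_left {i : ℕ} (h3 : ExtZero R V Z i) (h2 : ExtZero R V Y (i + 1)) :
    ExtZero R V X (i + 1) := fun e => by
  obtain ⟨x, rfl⟩ := Ext.covariant_sequence_exact₁ _ (exactComplex_shortExact h hf hg) e
    (h2 _) rfl
  rw [h3 x, Ext.zero_comp]

lemma ExtZero.exists_extend (h3 : ExtZero R Z V 1) (φ : X →ₗ[R] V) :
    ∃ ψ : Y →ₗ[R] V, ψ ∘ₗ f = φ := by
  obtain ⟨x, hx⟩ := Ext.contravariant_sequence_exact₁ (exactComplex_shortExact h hf hg) _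
    (Ext.mk₀ (ModuleCat.ofHom φ)) (add_zero 1) (h3 _)
  obtain ⟨ψ, rfl⟩ := (Ext.mk₀_bijective _ _).2 x
  rw [Ext.mk₀_comp_mk₀, (Ext.mk₀_bijective _ _).1.eq_iff] at hx
  exact ⟨ψ.hom, congrArg ModuleCat.Hom.hom hx⟩

lemma ExtKill.exists_extend {c : R} (h3 : ExtKill R c Z V 1) (φ : X →ₗ[R] V) :
    ∃ ψ : Y →ₗ[R] V, ψ ∘ₗ f = c • φ := by
  obtain ⟨x, hx⟩ := Ext.contravariant_sequence_exact₁ (exactComplex_shortExact h hf hg) _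
    (Ext.mk₀ (ModuleCat.ofHom (c • φ))) (add_zero 1) (by
      have : ModuleCat.ofHom (c • φ) = c • ModuleCat.ofHom φ := rfl
      rw [this, Ext.mk₀_smul, Ext.comp_smul, h3])
  obtain ⟨ψ, rfl⟩ := (Ext.mk₀_bijective _ _).2 x
  rw [Ext.mk₀_comp_mk₀, (Ext.mk₀_bijective _ _).1.eq_iff] at hx
  exact ⟨ψ.hom, congrArg ModuleCat.Hom.hom hx⟩

lemma ExtZero.exists_lift (h1 : ExtZero R V X 1) (φ : V →ₗ[R] Z) :
    ∃ ψ : V →ₗ[R] Y, g ∘ₗ ψ = φ := by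
  obtain ⟨x, hx⟩ := Ext.covariant_sequence_exact₃ _ (exactComplex_shortExact h hf hg)
    (Ext.mk₀ (ModuleCat.ofHom φ)) (zero_add 1) (h1 _)
  obtain ⟨ψ, rfl⟩ := (Ext.mk₀_bijective _ _).2 x
  rw [Ext.mk₀_comp_mk₀, (Ext.mk₀_bijective _ _).1.eq_iff] at hx
  exact ⟨ψ.hom, congrArg ModuleCat.Hom.hom hx⟩

/-- Every class in Ext^1(Z, V) is the connecting image of some X → V, and that image dies once the
map extends to Y. -/
lemma ExtZero.one_of_extend (h2 : ExtZero R Y V 1)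
    (H : ∀ φ : X →ₗ[R] V, ∃ ψ : Y →ₗ[R] V, ψ ∘ₗ f = φ) : ExtZero R Z V 1 := fun e => by
  have hS := exactComplex_shortExact h hf hg
  obtain ⟨x, rfl⟩ := Ext.contravariant_sequence_exact₃ hS _ e (h2 _) (add_zero 1)
  obtain ⟨φ, rfl⟩ := (Ext.mk₀_bijective _ _).2 x
  obtain ⟨ψ, hψ⟩ := H φ.hom
  have : φ = (exactComplex f g h).f ≫ ModuleCat.ofHom ψ := by
    ext1
    exact hψ.symm
  rw [this, ← Ext.mk₀_comp_mk₀, hS.extClass_comp_assoc]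

lemma ExtKill.contra_left {c : R} {i : ℕ} (h2 : ExtZero R Y V i) (h3 : ExtKill R c Z V (i + 1)) :
    ExtKill R c X V i := fun e => by
  obtain ⟨x, hx⟩ := Ext.contravariant_sequence_exact₁ (exactComplex_shortExact h hf hg) _ (c • e)
    (add_comm 1 i) (by rw [Ext.comp_smul]; exact h3 _)
  rw [← hx, h2 x, Ext.comp_zero]

lemma ExtKill.contra_left_mul {c d : R} {i : ℕ} (h2 : ExtKill R d Y V i)
    (h3 : ExtKill R c Z V (i + 1)) : ExtKill R (d * c) X V i := fun e => by
  obtain ⟨x, hx⟩ := Ext.contravariant_sequence_exact₁ (exactComplex_shortExact h hf hg) _ (c • e)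
    (add_comm 1 i) (by rw [Ext.comp_smul]; exact h3 _)
  rw [mul_smul, ← hx, ← Ext.comp_smul, h2 x, Ext.comp_zero]

lemma ExtKill.contra_mid {c : R} {i : ℕ} (h1 : ExtZero R X V i) (h3 : ExtKill R c Z V i) :
    ExtKill R c Y V i := fun e => by
  obtain ⟨x, rfl⟩ := Ext.contravariant_sequence_exact₂ (exactComplex_shortExact h hf hg) _ e
    (h1 _)
  rw [← Ext.comp_smul, h3 x, Ext.comp_zero]

end LongExact

/-- `Ext(X, V)` is annihilated by what annihilates `X`. -/
lemma ExtKill.of_smul_eq_zero {c : R} (hc : ∀ x : X, c • x = 0) (i : ℕ) : ExtKill R c X V i :=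
  (ExtZero.of_subsingleton_left (X := PUnit.{u + 1})).kill_of_factor 0 0 c (by simp [hc])

lemma hasProjectiveDimensionLT_of_extZero [IsNoetherianRing R] [Module.Finite R X] (n : ℕ)
    (h : ∀ (L : Type u) [AddCommGroup L] [Module R L] [Module.Finite R L], ExtZero R X L n) :
    HasProjectiveDimensionLT (ModuleCat.of R X) n :=
  ModuleCat.hasProjectiveDimensionLT_of_forall_finite (ModuleCat.of R X) n
    fun L _ => extZero_iff_subsingleton.mp (h L)

lemma ExtZero.of_hasProjectiveDimensionLT {n : ℕ}
    (h : HasProjectiveDimensionLT (ModuleCat.of R X) n) {i : ℕ} (hi : n ≤ i) :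
    ExtZero R X V i :=
  fun e => e.eq_zero_of_hasProjectiveDimensionLT n hi

lemma projective_of_hasProjectiveDimensionLT_one
    (h : HasProjectiveDimensionLT (ModuleCat.of R X) 1) : Module.Projective R X := by
  rw [← projective_iff_hasProjectiveDimensionLT_one] at h
  exact (IsProjective.iff_projective (R := R) X).mpr h

lemma hasProjectiveDimensionLT_one_of_projective [Module.Projective R X] :
    HasProjectiveDimensionLT (ModuleCat.of R X) 1 := by
  rw [← projective_iff_hasProjectiveDimensionLT_one]
  exact (IsProjective.iff_projective (R := R) X).mp inferInstance

end ExtVanishing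

/-! ### Dimension shifting along finite resolutions -/

section Resolutions

variable {R : Type u} [CommRing R]

lemma exact_rangeRestrict_zero {A B C : Type*} [AddCommGroup A] [Module R A] [AddCommGroup B]
    [Module R B] [AddCommGroup C] [Module R C] {f : A →ₗ[R] B} {g : B →ₗ[R] C}
    (h : Function.Exact f g) : Function.Exact f g.rangeRestrict := by
  intro x
  rw [← h x, Subtype.ext_iff]
  rfl

lemma exact_subtype_range {A B C : Type*} [AddCommGroup A] [Module R A] [AddCommGroup B]
    [Module R B] [AddCommGroup C] [Module R C] {f : A →ₗ[R] B} {g : B →ₗ[R] C}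
    (h : Function.Exact f g) : Function.Exact (LinearMap.range f).subtype g := by
  intro x
  rw [h x]
  simp

lemma ExtZero.of_left_resolution {V : Type u} [AddCommGroup V] [Module R V] (n : ℕ) :
    ∀ {P : ℕ → Type u} [∀ i, AddCommGroup (P i)] [∀ i, Module R (P i)]
      {M : Type u} [AddCommGroup M] [Module R M]
      (d : ∀ i, P (i + 1) →ₗ[R] P i) (ε : P 0 →ₗ[R] M),
      Function.Surjective ε → Function.Exact (d 0) ε →
      (∀ i, Function.Exact (d (i + 1)) (d i)) → (∀ i, n < i → Subsingleton (P i)) →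
      (∀ i j, 1 ≤ j → ExtZero R (P i) V j) → ∀ j, n < j → ExtZero R M V j := by
  induction n with
  | zero =>
    intro P _ _ M _ _ d ε hε h0 _ hs hP j hj
    have := hs 1 one_pos
    have hinj : Function.Injective ε := by
      rw [← LinearMap.ker_eq_bot, LinearMap.exact_iff.mp h0, LinearMap.range_eq_bot]
      exact Subsingleton.elim _ _
    exact (hP 0 j hj).congr_left (LinearEquiv.ofBijective ε ⟨hinj, hε⟩).symm
  | succ n ih =>
    intro P _ _ M _ _ d ε hε h0 hd hs hP j hj
    obtain ⟨j, rfl⟩ := Nat.exists_eq_add_of_le' (show 1 ≤ j by omega)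
    refine ExtZero.contra_right (exact_subtype_range h0) (Submodule.subtype_injective _) hε ?_
      (hP 0 _ (by omega))
    exact ih (P := fun i => P (i + 1)) (fun i => d (i + 1)) (d 0).rangeRestrict
      (LinearMap.surjective_rangeRestrict _) (exact_rangeRestrict_zero (hd 0))
      (fun i => hd (i + 1)) (fun i hi => hs _ (by omega)) (fun i => hP (i + 1)) j (by omega)

/-- Ext^j(V, M) sits between Ext^j(V, P 0) and Ext^{j+1}(V, syzygy). Shifting only raises degrees,
so the bound `q` does not deteriorate with the length. -/
lemma ExtZero.to_left_resolution {V : Type u} [AddCommGroup V] [Module R V] (q n : ℕ) :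
    ∀ {P : ℕ → Type u} [∀ i, AddCommGroup (P i)] [∀ i, Module R (P i)]
      {M : Type u} [AddCommGroup M] [Module R M]
      (d : ∀ i, P (i + 1) →ₗ[R] P i) (ε : P 0 →ₗ[R] M),
      Function.Surjective ε → Function.Exact (d 0) ε →
      (∀ i, Function.Exact (d (i + 1)) (d i)) → (∀ i, n < i → Subsingleton (P i)) →
      (∀ i j, q < j → ExtZero R V (P i) j) → ∀ j, q < j → ExtZero R V M j := by
  induction n with
  | zero =>
    intro P _ _ M _ _ d ε hε h0 _ hs hP j hj
    have := hs 1 one_pos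
    have hinj : Function.Injective ε := by
      rw [← LinearMap.ker_eq_bot, LinearMap.exact_iff.mp h0, LinearMap.range_eq_bot]
      exact Subsingleton.elim _ _
    exact (hP 0 j hj).congr_right (LinearEquiv.ofBijective ε ⟨hinj, hε⟩).symm
  | succ n ih =>
    intro P _ _ M _ _ d ε hε h0 hd hs hP j hj
    refine ExtZero.cov_right (exact_subtype_range h0) (Submodule.subtype_injective _) hε
      (hP 0 _ hj) ?_
    exact ih (P := fun i => P (i + 1)) (fun i => d (i + 1)) (d 0).rangeRestrict
      (LinearMap.surjective_rangeRestrict _) (exact_rangeRestrict_zero (hd 0))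
      (fun i => hd (i + 1)) (fun i hi => hs _ (by omega)) (fun i => hP (i + 1)) _ (by omega)

lemma exact_quotient_lift {A B C D : Type*} [AddCommGroup A] [Module R A] [AddCommGroup B]
    [Module R B] [AddCommGroup C] [Module R C] [AddCommGroup D] [Module R D]
    {f : A →ₗ[R] B} {g : B →ₗ[R] C} {k : C →ₗ[R] D} (h : Function.Exact f g)
    (hk : Function.Exact g k) :
    ∃ g' : (B ⧸ LinearMap.range f) →ₗ[R] C, Function.Injective g' ∧ Function.Exact g' k := by
  refine ⟨(LinearMap.range f).liftQ g (by rw [← LinearMap.exact_iff.mp h]), ?_, ?_⟩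
  · rw [← LinearMap.ker_eq_bot, Submodule.ker_liftQ, LinearMap.exact_iff.mp h]
    exact Submodule.mkQ_map_self _
  · intro x
    rw [hk x]
    constructor
    · rintro ⟨y, rfl⟩
      exact ⟨Submodule.Quotient.mk y, rfl⟩
    · rintro ⟨y, rfl⟩
      obtain ⟨y, rfl⟩ := Submodule.Quotient.mk_surjective _ y
      exact ⟨y, rfl⟩

lemma exact_mkQ_range {A B : Type*} [AddCommGroup A] [Module R A] [AddCommGroup B]
    [Module R B] (f : A →ₗ[R] B) : Function.Exact f (LinearMap.range f).mkQ := by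
  rw [LinearMap.exact_iff, Submodule.ker_mkQ]

lemma ExtZero.of_right_resolution {V : Type u} [AddCommGroup V] [Module R V] (n : ℕ) :
    ∀ {Q : ℕ → Type u} [∀ i, AddCommGroup (Q i)] [∀ i, Module R (Q i)]
      {M : Type u} [AddCommGroup M] [Module R M]
      (η : M →ₗ[R] Q 0) (d : ∀ i, Q i →ₗ[R] Q (i + 1)),
      Function.Injective η → Function.Exact η (d 0) →
      (∀ i, Function.Exact (d i) (d (i + 1))) → (∀ i, n < i → Subsingleton (Q i)) →
      (∀ i j, 1 ≤ j → ExtZero R (Q i) V j) → ∀ j, 1 ≤ j → ExtZero R M V j := by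
  induction n with
  | zero =>
    intro Q _ _ M _ _ η d hη h0 _ hs hQ j hj
    have := hs 1 one_pos
    have hsurj : Function.Surjective η := fun x => (h0 x).mp (Subsingleton.elim _ _)
    exact (hQ 0 j hj).congr_left (LinearEquiv.ofBijective η ⟨hη, hsurj⟩)
  | succ n ih =>
    intro Q _ _ M _ _ η d hη h0 hd hs hQ j hj
    obtain ⟨g', hg', hk⟩ := exact_quotient_lift h0 (hd 0)
    refine ExtZero.contra_left (exact_mkQ_range η) hη (Submodule.mkQ_surjective _)
      (hQ 0 _ hj) ?_
    exact ih (Q := fun i => Q (i + 1)) g' (fun i => d (i + 1)) hg' hk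
      (fun i => hd (i + 1)) (fun i hi => hs _ (by omega)) (fun i => hQ (i + 1)) _ (by omega)

lemma ExtZero.to_right_resolution {V : Type u} [AddCommGroup V] [Module R V] (n : ℕ) :
    ∀ {Q : ℕ → Type u} [∀ i, AddCommGroup (Q i)] [∀ i, Module R (Q i)]
      {M : Type u} [AddCommGroup M] [Module R M]
      (η : M →ₗ[R] Q 0) (d : ∀ i, Q i →ₗ[R] Q (i + 1)),
      Function.Injective η → Function.Exact η (d 0) →
      (∀ i, Function.Exact (d i) (d (i + 1))) → (∀ i, n < i → Subsingleton (Q i)) →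
      (∀ i j, 1 ≤ j → ExtZero R V (Q i) j) → ∀ j, n < j → ExtZero R V M j := by
  induction n with
  | zero =>
    intro Q _ _ M _ _ η d hη h0 _ hs hQ j hj
    have := hs 1 one_pos
    have hsurj : Function.Surjective η := fun x => (h0 x).mp (Subsingleton.elim _ _)
    exact (hQ 0 j hj).congr_right (LinearEquiv.ofBijective η ⟨hη, hsurj⟩)
  | succ n ih =>
    intro Q _ _ M _ _ η d hη h0 hd hs hQ j hj
    obtain ⟨g', hg', hk⟩ := exact_quotient_lift h0 (hd 0)
    obtain ⟨j, rfl⟩ := Nat.exists_eq_add_of_le' (show 1 ≤ j by omega)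
    refine ExtZero.cov_left (exact_mkQ_range η) hη (Submodule.mkQ_surjective _) ?_
      (hQ 0 _ (by omega))
    exact ih (Q := fun i => Q (i + 1)) g' (fun i => d (i + 1)) hg' hk
      (fun i => hd (i + 1)) (fun i hi => hs _ (by omega)) (fun i => hQ (i + 1)) _ (by omega)

end Resolutions

/-! ### Ext between modules Hom(C, I) with I injective -/

section HomInjective

open TensorProduct

variable {R : Type u} [CommRing R]

lemma exists_extend_of_injective {X Y I : Type u} [AddCommGroup X] [Module R X] [AddCommGroup Y]
    [Module R Y] [AddCommGroup I] [Module R I] [hI : Module.Injective R I] {f : X →ₗ[R] Y}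
    (hf : Function.Injective f) (g : X →ₗ[R] I) : ∃ h : Y →ₗ[R] I, h ∘ₗ f = g := by
  obtain ⟨h, hh⟩ := hI.out f hf g
  exact ⟨h, LinearMap.ext hh⟩

lemma injective_hom_of_flat {F I : Type u} [AddCommGroup F] [Module R F] [Module.Flat R F]
    [AddCommGroup I] [Module R I] [Module.Injective R I] : Module.Injective R (F →ₗ[R] I) where
  out X Y _ _ _ _ f hf g := by
    obtain ⟨h, hh⟩ := exists_extend_of_injective
      (Module.Flat.rTensor_preserves_injective_linearMap (M := F) f hf) (TensorProduct.lift g)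
    refine ⟨TensorProduct.curry h, fun x => ?_⟩
    ext y
    simpa using LinearMap.congr_fun hh (x ⊗ₜ y)

lemma exact_hom_injective {X Y Z I : Type u} [AddCommGroup X] [Module R X] [AddCommGroup Y]
    [Module R Y] [AddCommGroup Z] [Module R Z] [AddCommGroup I] [Module R I]
    {f : X →ₗ[R] Y} {g : Y →ₗ[R] Z} (h : Function.Exact f g) (hg : Function.Surjective g) :
    Function.Exact (LinearMap.lcomp R I g) (LinearMap.lcomp R I f) := by
  intro φ
  constructor
  · intro hφ
    refine ⟨(LinearMap.ker g).liftQ φ ?_ ∘ₗ (g.quotKerEquivOfSurjective hg).symm.toLinearMap, ?_⟩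
    · rw [LinearMap.exact_iff.mp h]
      rintro _ ⟨x, rfl⟩
      exact LinearMap.congr_fun hφ x
    · ext y
      have : (g.quotKerEquivOfSurjective hg).symm (g y) = Submodule.Quotient.mk y := by
        rw [LinearEquiv.symm_apply_eq]
        rfl
      simp [this]
  · rintro ⟨ψ, rfl⟩
    ext x
    simp [h.apply_apply_eq_zero]

lemma lcomp_injective {Y Z I : Type u} [AddCommGroup Y]
    [Module R Y] [AddCommGroup Z] [Module R Z] [AddCommGroup I] [Module R I]
    {g : Y →ₗ[R] Z} (hg : Function.Surjective g) : Function.Injective (LinearMap.lcomp R I g) := by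
  intro a b hab
  ext x
  obtain ⟨y, rfl⟩ := hg x
  exact LinearMap.congr_fun hab y

lemma lcomp_surjective {X Y I : Type u} [AddCommGroup X] [Module R X] [AddCommGroup Y]
    [Module R Y] [AddCommGroup I] [Module R I] [Module.Injective R I]
    {f : X →ₗ[R] Y} (hf : Function.Injective f) : Function.Surjective (LinearMap.lcomp R I f) :=
  exists_extend_of_injective hf

/-- Both Ext^j(X, Hom(Z, I)) and Ext^j(Z, Hom(X, I)) are Hom(Tor_j(X, Z), I). Without Tor: in degree
one, flipping arguments turns extending K → Hom(Z, I) to a free cover of X into lifting Z → Hom(K,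
I). Higher degrees pass to the syzygy of X, for which all positive degrees of the hypothesis are
needed. -/
lemma ExtZero.hom_swap {I : Type u} [AddCommGroup I] [Module R I] [Module.Injective R I]
    {Z : Type u} [AddCommGroup Z] [Module R Z] (j : ℕ) :
    ∀ {X : Type u} [AddCommGroup X] [Module R X],
      (∀ j, 1 ≤ j → ExtZero R Z (X →ₗ[R] I) j) → ExtZero R X (Z →ₗ[R] I) (j + 1) := by
  induction j with
  | zero =>
    intro X _ _ hX
    let π : (X →₀ R) →ₗ[R] X := Finsupp.linearCombination R id
    have hπ : Function.Surjective π := Finsupp.linearCombination_id_surjective R X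
    have hex : Function.Exact (LinearMap.ker π).subtype π := LinearMap.exact_subtype_ker_map π
    refine ExtZero.one_of_extend hex (Submodule.subtype_injective _) hπ
      (ExtZero.of_projective le_rfl) fun φ => ?_
    obtain ⟨ψ, hψ⟩ := ExtZero.exists_lift (exact_hom_injective (I := I) hex hπ)
      (lcomp_injective hπ) (lcomp_surjective (Submodule.subtype_injective _)) (hX 1 le_rfl) φ.flip
    refine ⟨ψ.flip, ?_⟩
    ext x z
    exact LinearMap.congr_fun (LinearMap.congr_fun hψ z) x
  | succ j ih =>
    intro X _ _ hX
    let π : (X →₀ R) →ₗ[R] X := Finsupp.linearCombination R id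
    have hπ : Function.Surjective π := Finsupp.linearCombination_id_surjective R X
    have hex : Function.Exact (LinearMap.ker π).subtype π := LinearMap.exact_subtype_ker_map π
    have := injective_hom_of_flat (R := R) (F := X →₀ R) (I := I)
    refine ExtZero.contra_right hex (Submodule.subtype_injective _) hπ (ih fun j hj => ?_)
      (ExtZero.of_projective (by omega))
    exact ExtZero.cov_right (exact_hom_injective (I := I) hex hπ)
      (lcomp_injective hπ) (lcomp_surjective (Submodule.subtype_injective _)) (ExtZero.of_injective hj) (hX _ (by omega))

variable (C I : Type u) [AddCommGroup C] [Module R C] [AddCommGroup I] [Module R I]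

/-- The evaluation map `K ⊗ Hom(C, I) → Hom(Hom(K, C), I)`. -/
def tensorHomEval (K : Type u) [AddCommGroup K] [Module R K] :
    K ⊗[R] (C →ₗ[R] I) →ₗ[R] ((K →ₗ[R] C) →ₗ[R] I) :=
  TensorProduct.lift
    (LinearMap.mk₂ R (fun k h => h ∘ₗ (LinearMap.applyₗ k : (K →ₗ[R] C) →ₗ[R] C))
      (fun _ _ _ => by ext; simp) (fun _ _ _ => by ext; simp)
      (fun _ _ _ => by ext; simp) (fun _ _ _ => by ext; simp))

lemma tensorHomEval_naturality {K L : Type u} [AddCommGroup K] [Module R K] [AddCommGroup L]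
    [Module R L] (f : K →ₗ[R] L) (z : K ⊗[R] (C →ₗ[R] I)) (φ : L →ₗ[R] C) :
    tensorHomEval C I L (f.rTensor _ z) φ = tensorHomEval C I K z (φ ∘ₗ f) := by
  induction z using TensorProduct.induction_on with
  | zero => simp
  | tmul k h => rfl
  | add a b ha hb => simp [ha, hb]

lemma tensorHomEval_tmul (K : Type u) [AddCommGroup K] [Module R K] (k : K) (h : C →ₗ[R] I)
    (φ : K →ₗ[R] C) : tensorHomEval C I K (k ⊗ₜ h) φ = h (φ k) := rfl

lemma tensorHomEval_free_bijective (b : ℕ) :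
    Function.Bijective (tensorHomEval (R := R) C I (Fin b → R)) := by
  classical
  have key : ∀ (w : Fin b → (C →ₗ[R] I)) (φ : (Fin b → R) →ₗ[R] C),
      tensorHomEval C I (Fin b → R) (∑ i, Pi.single i 1 ⊗ₜ w i) φ =
        ∑ i, w i (φ (Pi.single i 1)) := by
    intro w φ
    simp [map_sum, LinearMap.sum_apply, tensorHomEval_tmul]
  have rep : ∀ z : (Fin b → R) ⊗[R] (C →ₗ[R] I), ∃ w : Fin b → (C →ₗ[R] I),
      z = ∑ i, Pi.single i 1 ⊗ₜ w i := by
    intro z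
    induction z using TensorProduct.induction_on with
    | zero => exact ⟨0, by simp⟩
    | tmul k h =>
      refine ⟨fun i => k i • h, ?_⟩
      conv_lhs => rw [pi_eq_sum_univ' k, TensorProduct.sum_tmul]
      refine Finset.sum_congr rfl fun i _ => ?_
      rw [TensorProduct.tmul_smul, TensorProduct.smul_tmul']
    | add x y hx hy =>
      obtain ⟨w, rfl⟩ := hx
      obtain ⟨w', rfl⟩ := hy
      exact ⟨w + w', by simp [TensorProduct.tmul_add, Finset.sum_add_distrib]⟩
  have eval : ∀ (i : Fin b) (c : C) (w : Fin b → (C →ₗ[R] I)),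
      ∑ j, w j (((LinearMap.proj i : (Fin b → R) →ₗ[R] R).smulRight c) (Pi.single j 1)) =
        w i c := by
    intro i c w
    rw [Finset.sum_eq_single i]
    · simp
    · intro j _ hj
      simp [hj.symm]
    · simp
  constructor
  · rw [injective_iff_map_eq_zero]
    intro z hz
    obtain ⟨w, rfl⟩ := rep z
    refine Finset.sum_eq_zero fun i _ => ?_
    have : w i = 0 := by
      ext c
      rw [← eval i c w, ← key, hz]
      rfl
    rw [this, TensorProduct.tmul_zero]
  · intro l
    refine ⟨∑ i, Pi.single i 1 ⊗ₜ
      (l ∘ₗ (LinearMap.smulRightₗ (LinearMap.proj i : (Fin b → R) →ₗ[R] R))), ?_⟩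
    ext φ
    rw [key]
    simp only [LinearMap.comp_apply, ← map_sum]
    congr 1
    ext j
    simp [LinearMap.smulRightₗ_apply, Pi.single_apply]

/-- Present K by R^b → R^a and lift an element of the kernel to τ over R^a. The functional of τ on
Hom(R^a, C) kills Hom(K, C), so it factors through the image in Hom(R^b, C) and extends to all of it
by injectivity of I. The free case makes this extension an element over R^b mapping to τ. -/
lemma tensorHomEval_injective [IsNoetherianRing R] [Module.Injective R I] (K : Type u)
    [AddCommGroup K] [Module R K] [Module.Finite R K] :
    Function.Injective (tensorHomEval (R := R) C I K) := by
  obtain ⟨a, π, hπ⟩ := Module.Finite.exists_fin' R K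
  obtain ⟨b, ρ, hρ⟩ := Module.Finite.exists_fin' R (LinearMap.ker π)
  set d : (Fin b → R) →ₗ[R] (Fin a → R) := (LinearMap.ker π).subtype ∘ₗ ρ
  have hd : Function.Exact d π := by
    rw [LinearMap.exact_iff, LinearMap.range_comp, LinearMap.range_eq_top.mpr hρ]
    simp
  rw [injective_iff_map_eq_zero]
  intro z hz
  obtain ⟨τ, rfl⟩ := LinearMap.rTensor_surjective (C →ₗ[R] I) hπ z
  have hker : LinearMap.ker (LinearMap.lcomp R C d) ≤
      LinearMap.ker (tensorHomEval C I (Fin a → R) τ) := by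
    intro φ hφ
    obtain ⟨ψ, rfl⟩ := (exact_hom_injective (I := C) hd hπ φ).mp hφ
    have := tensorHomEval_naturality C I π τ ψ
    rw [hz] at this
    exact this.symm
  obtain ⟨l, hl⟩ := exists_extend_of_injective
    (f := (LinearMap.ker (LinearMap.lcomp R C d)).liftQ (LinearMap.lcomp R C d) le_rfl)
    (by rw [← LinearMap.ker_eq_bot, Submodule.ker_liftQ_eq_bot']; rfl)
    ((LinearMap.ker (LinearMap.lcomp R C d)).liftQ (tensorHomEval C I (Fin a → R) τ) hker)
  obtain ⟨σ, hσ⟩ := (tensorHomEval_free_bijective C I b).2 l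
  have hτ : τ = d.rTensor _ σ := by
    refine (tensorHomEval_free_bijective C I a).1 ?_
    ext1 φ
    rw [tensorHomEval_naturality, hσ]
    exact (LinearMap.congr_fun hl (Submodule.Quotient.mk φ)).symm
  rw [hτ, ← LinearMap.comp_apply, ← LinearMap.rTensor_comp, hd.linearMap_comp_eq_zero,
    LinearMap.rTensor_zero, LinearMap.zero_apply]

variable {C} in
-- With K the syzygy of Z, maps K → C extend to the free cover because Ext^1(Z, C) = 0. Through
-- `tensorHomEval_injective` this makes K → F injective after tensoring with Hom(C, I), and maps
-- from K ⊗ Hom(C, I) to the injective I' then extend.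
lemma ExtZero.hom_hom [IsNoetherianRing R] {I' : Type u} [AddCommGroup I'] [Module R I']
    [Module.Injective R I] [Module.Injective R I'] (j : ℕ) :
    ∀ {Z : Type u} [AddCommGroup Z] [Module R Z] [Module.Finite R Z],
      (∀ j, 1 ≤ j → ExtZero R Z C j) → ExtZero R Z ((C →ₗ[R] I) →ₗ[R] I') (j + 1) := by
  induction j with
  | zero =>
    intro Z _ _ _ hZ
    obtain ⟨a, π, hπ⟩ := Module.Finite.exists_fin' R Z
    have hex : Function.Exact (LinearMap.ker π).subtype π := LinearMap.exact_subtype_ker_map π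
    refine ExtZero.one_of_extend hex (Submodule.subtype_injective _) hπ
      (ExtZero.of_projective le_rfl) fun φ => ?_
    have hinj : Function.Injective
        ((LinearMap.ker π).subtype.rTensor (C →ₗ[R] I)) := by
      rw [injective_iff_map_eq_zero]
      intro z hz
      refine (injective_iff_map_eq_zero _).mp (tensorHomEval_injective C I (LinearMap.ker π)) z ?_
      ext ψ
      obtain ⟨χ, rfl⟩ := ExtZero.exists_extend hex (Submodule.subtype_injective _) hπ
        (hZ 1 le_rfl) ψ
      rw [← tensorHomEval_naturality, hz]
      simp
    obtain ⟨h, hh⟩ := exists_extend_of_injective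
      (X := LinearMap.ker π ⊗[R] (C →ₗ[R] I)) hinj (TensorProduct.lift φ)
    refine ⟨TensorProduct.curry h, ?_⟩
    ext x y
    simpa using LinearMap.congr_fun hh (x ⊗ₜ y)
  | succ j ih =>
    intro Z _ _ _ hZ
    obtain ⟨a, π, hπ⟩ := Module.Finite.exists_fin' R Z
    have hex : Function.Exact (LinearMap.ker π).subtype π := LinearMap.exact_subtype_ker_map π
    refine ExtZero.contra_right hex (Submodule.subtype_injective _) hπ (ih fun j hj => ?_)
      (ExtZero.of_projective (by omega))
    exact ExtZero.contra_left hex (Submodule.subtype_injective _) hπ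
      (ExtZero.of_projective hj) (hZ _ (by omega))

end HomInjective

/-! ### Vanishing of the high self-extensions of M -/

section SelfExt

variable {R : Type u} [CommRing R] {C M : Type u} [AddCommGroup C] [Module R C]
  [AddCommGroup M] [Module R M]

lemma IsSemidualizing.extZero (hC : IsSemidualizing R C) {j : ℕ} (hj : 1 ≤ j) :
    ExtZero R C C j :=
  extZero_iff_subsingleton.mpr (hC.ext_eq_zero j hj)

lemma exists_extZero_self_of_cProjectiveDimension (hC : IsSemidualizing R C)
    (h : cProjectiveDimension R C M < ⊤) : ∃ n, ∀ j, n < j → ExtZero R M M j := by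
  simp only [cProjectiveDimension, iInf_lt_top] at h
  obtain ⟨n, ⟨b, d, ε, -, hb, hε, h0, hd⟩, -⟩ := h
  have hs : ∀ i, n < i → Subsingleton (Fin (b i) → C) := fun i hi => by
    rw [hb i hi]
    infer_instance
  refine ⟨n, ExtZero.to_left_resolution n n d ε hε h0 hd hs fun i => ?_⟩
  exact ExtZero.of_left_resolution n d ε hε h0 hd hs fun _ j hj =>
    ((hC.extZero hj).pi_right _).pi_left _

lemma exists_extZero_self_of_cInjectiveDimension [IsNoetherianRing R] [Module.Finite R C]
    (hC : IsSemidualizing R C)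
    (h : cInjectiveDimension R C M < ⊤) : ∃ n, ∀ j, n < j → ExtZero R M M j := by
  simp only [cInjectiveDimension, iInf_lt_top] at h
  obtain ⟨n, ⟨I, η, d, hI, hs, hη, h0, hd⟩, -⟩ := h
  have hs' : ∀ i, n < i → Subsingleton (C →ₗ[R] I i) := fun i hi => by
    have := hs i hi
    infer_instance
  refine ⟨n, ExtZero.to_right_resolution n η d hη h0 hd hs' fun i => ?_⟩
  refine ExtZero.of_right_resolution n η d hη h0 hd hs' fun k j hj => ?_
  obtain ⟨j, rfl⟩ := Nat.exists_eq_add_of_le' hj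
  refine ExtZero.hom_swap j fun l hl => ?_
  obtain ⟨l, rfl⟩ := Nat.exists_eq_add_of_le' hl
  exact ExtZero.hom_hom _ l fun _ => hC.extZero

end SelfExt

/-! ### Cones of multiplication by elements of the maximal ideal -/

section Cone

variable {R : Type u} [CommRing R]

/-- `X` has finite projective dimension. -/
def FinitePd (R : Type u) [CommRing R] (X : Type u) [AddCommGroup X] [Module R X] : Prop :=
  ∃ n, HasProjectiveDimensionLT (ModuleCat.of R X) n

/-- The cone of multiplication by `x`, made into a module by means of a free cover `π`. -/
abbrev smulCone {Y Φ : Type u} [AddCommGroup Y] [Module R Y] [AddCommGroup Φ] [Module R Φ]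
    (x : R) (π : Φ →ₗ[R] Y) : Submodule R (Y × Φ) :=
  LinearMap.ker ((x • LinearMap.id).coprod π)

variable {Y Φ : Type u} [AddCommGroup Y] [Module R Y] [AddCommGroup Φ] [Module R Φ]
  (x : R) {π : Φ →ₗ[R] Y} (hπ : Function.Surjective π)

include hπ in
lemma smulCone_surjective : Function.Surjective ((x • LinearMap.id).coprod π) := fun y => by
  obtain ⟨φ, rfl⟩ := hπ y
  exact ⟨(0, φ), by simp⟩

include hπ in
-- In the sequence 0 → cone → Y ⊕ Φ → Y → 0, vanishing of Ext^p(cone, L) makes multiplication by x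
-- surjective on Ext^p(Y, L). This module is finitely generated for L finitely generated, so
-- Nakayama applies.
lemma finitePd_of_smulCone [IsLocalRing R] [IsNoetherianRing R] [Module.Finite R Y]
    (hx : x ∈ IsLocalRing.maximalIdeal R) (h : FinitePd R (smulCone x π)) : FinitePd R Y := by
  obtain ⟨p, hp⟩ := h
  refine ⟨p, hasProjectiveDimensionLT_of_extZero p fun L _ _ _ => ?_⟩
  have hdiv : ∀ e : Ext (ModuleCat.of R Y) (ModuleCat.of R L) p, ∃ e', e = x • e' := by
    intro e
    obtain ⟨e', he'⟩ := Ext.contravariant_sequence_exact₂ (exactComplex_shortExact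
      (LinearMap.exact_subtype_ker_map _) (Submodule.subtype_injective _)
      (smulCone_surjective x hπ)) _
      ((Ext.mk₀ (ModuleCat.ofHom (LinearMap.fst R Y Φ))).comp e (zero_add p))
      (ExtZero.of_hasProjectiveDimensionLT hp le_rfl _)
    refine ⟨e', ?_⟩
    have h1 := congrArg (fun t => (Ext.mk₀ (ModuleCat.ofHom (LinearMap.inl R Y Φ))).comp t
      (zero_add p)) he'
    simp only [Ext.mk₀_comp_mk₀_assoc] at h1
    have h2 : ModuleCat.ofHom (LinearMap.inl R Y Φ) ≫ ModuleCat.ofHom (LinearMap.fst R Y Φ) =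
        𝟙 _ := by
      ext; simp
    have h3 : ModuleCat.ofHom (LinearMap.inl R Y Φ) ≫
        ModuleCat.ofHom ((x • LinearMap.id).coprod π) = x • 𝟙 (ModuleCat.of R Y) := by
      ext; simp
    rw [h2, h3, Ext.mk₀_smul, Ext.smul_comp, Ext.mk₀_id_comp, Ext.mk₀_id_comp] at h1
    exact h1.symm
  have hfin : Module.Finite R (Ext (ModuleCat.of R Y) (ModuleCat.of R L) p) :=
    ModuleCat.finite_ext R _ _ p
  have htop : (⊤ : Submodule R (Ext (ModuleCat.of R Y) (ModuleCat.of R L) p)) = ⊥ := by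
    refine Submodule.eq_bot_of_le_smul_of_le_jacobson_bot (IsLocalRing.maximalIdeal R) _
      hfin.1 (fun e _ => ?_) (IsLocalRing.maximalIdeal_le_jacobson _)
    obtain ⟨e', rfl⟩ := hdiv e
    exact Submodule.smul_mem_smul hx trivial
  intro e
  exact (Submodule.mem_bot R).mp (htop ▸ Submodule.mem_top)

variable [Module.Projective R Φ]

/-- Multiplication by x on the cone factors through the projective Φ, as (y, φ) ↦ φ ↦ (-πφ, xφ): on
the cone xy = -πφ. -/
lemma smulCone_extKill_self (π : Φ →ₗ[R] Y) (V : Type u) [AddCommGroup V] [Module R V] {j : ℕ}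
    (hj : 1 ≤ j) : ExtKill R x (smulCone x π) V j := by
  refine (ExtZero.of_projective (R := R) (X := Φ) hj).kill_of_factor
    (LinearMap.snd R Y Φ ∘ₗ (smulCone x π).subtype)
    (LinearMap.codRestrict _ ((-π).prod (x • LinearMap.id)) fun φ => ?_) x fun z => ?_
  · simp
  · ext
    · have := z.2
      simp only [LinearMap.mem_ker, LinearMap.coprod_apply, LinearMap.smul_apply,
        LinearMap.id_apply] at this
      simp [eq_neg_of_add_eq_zero_left this]
    · simp

include hπ in
lemma smulCone_extKill_mul {c : R} {V : Type u} [AddCommGroup V] [Module R V]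
    (h : ∀ j, 1 ≤ j → ExtKill R c Y V j) {j : ℕ} (hj : 1 ≤ j) :
    ExtKill R (c * c) (smulCone x π) V j :=
  ExtKill.contra_left_mul (LinearMap.exact_subtype_ker_map _) (Submodule.subtype_injective _)
    (smulCone_surjective x hπ)
    (ExtKill.contra_mid Function.Exact.inr_fst LinearMap.inr_injective LinearMap.fst_surjective
      (ExtZero.of_projective hj) (h j hj)) (h _ (by omega))

include hπ in
lemma smulCone_extZero {V : Type u} [AddCommGroup V] [Module R V] {n : ℕ}
    (h : ∀ j, n < j → ExtZero R Y V j) {j : ℕ} (hj : n < j) :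
    ExtZero R (smulCone x π) V j :=
  ExtZero.contra_left (LinearMap.exact_subtype_ker_map _) (Submodule.subtype_injective _)
    (smulCone_surjective x hπ)
    (ExtZero.contra_mid Function.Exact.inr_fst LinearMap.inr_injective LinearMap.fst_surjective
      (ExtZero.of_projective (by omega)) (h j hj)) (h _ (by omega))

/-- Replacement of `M` by a module with the same vanishing of `Ext` into `V` whose `Ext` modules
are annihilated by powers of given elements. -/
lemma exists_extKill_list [IsLocalRing R] [IsNoetherianRing R] {M V : Type u} [AddCommGroup M]
    [Module R M] [Module.Finite R M] [AddCommGroup V] [Module R V] {n : ℕ}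
    (hM : ∀ j, n < j → ExtZero R M V j) (l : List R)
    (hl : ∀ x ∈ l, x ∈ IsLocalRing.maximalIdeal R) :
    ∃ (Y : Type u) (_ : AddCommGroup Y) (_ : Module R Y), Module.Finite R Y ∧
      (∀ j, n < j → ExtZero R Y V j) ∧
      (∀ x ∈ l, ∃ a : ℕ, ∀ (W : Type u) [AddCommGroup W] [Module R W] (j : ℕ), 1 ≤ j →
        ExtKill R (x ^ a) Y W j) ∧ (FinitePd R Y → FinitePd R M) := by
  induction l with
  | nil => exact ⟨M, inferInstance, inferInstance, inferInstance, hM, by simp, id⟩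
  | cons x l ih =>
    obtain ⟨Y, _, _, _, h1, h2, h3⟩ := ih fun y hy => hl y (List.mem_cons_of_mem _ hy)
    obtain ⟨b, π, hπ⟩ := Module.Finite.exists_fin' R Y
    refine ⟨smulCone x π, inferInstance, inferInstance, inferInstance,
      fun j hj => smulCone_extZero x hπ h1 hj, fun y hy => ?_,
      fun h => h3 (finitePd_of_smulCone x hπ (hl x List.mem_cons_self) h)⟩
    obtain rfl | hy := List.mem_cons.mp hy
    · exact ⟨1, fun W _ _ j hj => by simpa using smulCone_extKill_self y π W hj⟩
    · obtain ⟨a, ha⟩ := h2 y hy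
      refine ⟨a + a, fun W _ _ j hj => ?_⟩
      rw [pow_add]
      exact smulCone_extKill_mul x hπ (ha W) hj

end Cone

/-! ### Free resolutions, syzygies and cocycles -/

section FreeResolution

variable {R : Type u} [CommRing R]

lemma exists_next_syzygy [IsNoetherianRing R] {a b : ℕ} (f : (Fin a → R) →ₗ[R] (Fin b → R)) :
    ∃ p : Σ c : ℕ, ((Fin c → R) →ₗ[R] (Fin a → R)), Function.Exact p.2 f := by
  obtain ⟨c, ρ, hρ⟩ := Module.Finite.exists_fin' R (LinearMap.ker f)
  refine ⟨⟨c, (LinearMap.ker f).subtype ∘ₗ ρ⟩, ?_⟩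
  rw [LinearMap.exact_iff, LinearMap.range_comp, LinearMap.range_eq_top.mpr hρ]
  simp

/-- A finitely generated module over a Noetherian ring has a resolution by free modules of
finite rank. -/
lemma exists_free_resolution [IsNoetherianRing R] (Y : Type u) [AddCommGroup Y] [Module R Y]
    [Module.Finite R Y] :
    ∃ (b : ℕ → ℕ) (d : ∀ i, (Fin (b (i + 1)) → R) →ₗ[R] (Fin (b i) → R))
      (ε : (Fin (b 0) → R) →ₗ[R] Y), Function.Surjective ε ∧ Function.Exact (d 0) ε ∧
      ∀ i, Function.Exact (d (i + 1)) (d i) := by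
  obtain ⟨b₀, ε, hε⟩ := Module.Finite.exists_fin' R Y
  obtain ⟨b₁, ρ, hρ⟩ := Module.Finite.exists_fin' R (LinearMap.ker ε)
  let T := Σ (b : ℕ) (a : ℕ), ((Fin a → R) →ₗ[R] (Fin b → R))
  let nxt : T → T := fun t => ⟨t.2.1, (exists_next_syzygy t.2.2).choose⟩
  let s : ℕ → T := fun i => Nat.rec ⟨b₀, b₁, (LinearMap.ker ε).subtype ∘ₗ ρ⟩ (fun _ => nxt) i
  refine ⟨fun i => (s i).1, fun i => (s i).2.2, ε, hε, ?_, fun i => ?_⟩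
  · rw [LinearMap.exact_iff]
    change _ = LinearMap.range ((LinearMap.ker ε).subtype ∘ₗ ρ)
    rw [LinearMap.range_comp, LinearMap.range_eq_top.mpr hρ]
    simp
  · exact (exists_next_syzygy (s i).2.2).choose_spec

variable {b : ℕ → ℕ} {d : ∀ i, (Fin (b (i + 1)) → R) →ₗ[R] (Fin (b i) → R)}
  (hd : ∀ i, Function.Exact (d (i + 1)) (d i)) {Y : Type u} [AddCommGroup Y] [Module R Y]
  {ε : (Fin (b 0) → R) →ₗ[R] Y} (hε : Function.Surjective ε) (h0 : Function.Exact (d 0) ε)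

include hd in
lemma exact_syzygy (i : ℕ) :
    Function.Exact (LinearMap.range (d (i + 1))).subtype (d i).rangeRestrict :=
  exact_rangeRestrict_zero (exact_subtype_range (hd i))

include hd hε h0 in
lemma finitePd_of_syzygy (i : ℕ) (h : FinitePd R (LinearMap.range (d i))) : FinitePd R Y := by
  induction i with
  | zero =>
    obtain ⟨n, hn⟩ := h
    refine ⟨n + 1, (exactComplex_shortExact (exact_subtype_range h0)
      (Submodule.subtype_injective _) hε).hasProjectiveDimensionLT_X₃ n hn ?_⟩
    have : HasProjectiveDimensionLT (ModuleCat.of R (Fin (b 0) → R)) 1 :=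
      hasProjectiveDimensionLT_one_of_projective
    exact hasProjectiveDimensionLT_of_ge _ 1 _ (by omega)
  | succ i ih =>
    obtain ⟨n, hn⟩ := h
    refine ih ⟨n + 1, (exactComplex_shortExact (exact_syzygy hd i)
      (Submodule.subtype_injective _)
      (LinearMap.surjective_rangeRestrict _)).hasProjectiveDimensionLT_X₃ n hn ?_⟩
    have : HasProjectiveDimensionLT (ModuleCat.of R (Fin (b (i + 1)) → R)) 1 :=
      hasProjectiveDimensionLT_one_of_projective
    exact hasProjectiveDimensionLT_of_ge _ 1 _ (by omega)

include hd hε h0 in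
lemma extKill_syzygy {c : R} {V : Type u} [AddCommGroup V] [Module R V] (i : ℕ) :
    ∀ j, 1 ≤ j → ExtKill R c Y V (j + i + 1) → ExtKill R c (LinearMap.range (d i)) V j := by
  induction i with
  | zero =>
    intro j hj h
    exact ExtKill.contra_left (exact_subtype_range h0) (Submodule.subtype_injective _) hε
      (ExtZero.of_projective hj) h
  | succ i ih =>
    intro j hj h
    refine ExtKill.contra_left (exact_syzygy hd i) (Submodule.subtype_injective _)
      (LinearMap.surjective_rangeRestrict _) (ExtZero.of_projective hj)
      (ih _ (by omega) ?_)
    convert h using 1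
    omega

include hd hε h0 in
/-- Cocycles of a free resolution become coboundaries after multiplication by an element that
annihilates `Ext`. -/
lemma exists_coboundary {c : R} {V : Type u} [AddCommGroup V] [Module R V] (i : ℕ)
    (h : ExtKill R c Y V (i + 2)) (φ : (Fin (b (i + 2)) → R) →ₗ[R] V)
    (hφ : φ ∘ₗ d (i + 2) = 0) : ∃ ψ : (Fin (b (i + 1)) → R) →ₗ[R] V, ψ ∘ₗ d (i + 1) = c • φ := by
  -- The cocycle descends to the syzygy `range (d (i + 1))`; the obstruction to extending it over
  -- F_{i+1} lies in Ext^1(range (d i), V), which is shifted from Ext^{i+2}(Y, V).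
  have hk : LinearMap.ker (d (i + 1)).rangeRestrict ≤ LinearMap.ker φ := by
    rw [LinearMap.ker_rangeRestrict, LinearMap.exact_iff.mp (hd (i + 1))]
    rintro _ ⟨x, rfl⟩
    exact LinearMap.congr_fun hφ x
  obtain ⟨φ', hφ'⟩ := (exact_hom_injective (I := V)
    (LinearMap.exact_subtype_ker_map (d (i + 1)).rangeRestrict)
    (LinearMap.surjective_rangeRestrict _) φ).mp (by
      ext x
      exact hk x.2)
  obtain ⟨ψ, hψ⟩ := ExtKill.exists_extend (exact_syzygy hd i) (Submodule.subtype_injective _)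
    (LinearMap.surjective_rangeRestrict _)
    (extKill_syzygy hd hε h0 i 1 le_rfl (by convert h using 1; omega)) φ'
  refine ⟨ψ, ?_⟩
  ext1 x
  rw [← hφ']
  ext
  simpa using LinearMap.congr_fun hψ ((d (i + 1)).rangeRestrict (Pi.single x 1))

end FreeResolution

/-! ### Tor_1 by presentations, and duality of complexes -/

section TorVanishing

open TensorProduct

variable {R : Type u} [CommRing R]

lemma lTensor_lTensor_of_comp_eq {M A B C : Type*} [AddCommGroup M] [Module R M] [AddCommGroup A]
    [Module R A] [AddCommGroup B] [Module R B] [AddCommGroup C] [Module R C]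
    {f : A →ₗ[R] B} {g : B →ₗ[R] C} {h : A →ₗ[R] C} (hfg : g ∘ₗ f = h) (z : M ⊗[R] A) :
    g.lTensor M (f.lTensor M z) = h.lTensor M z := by
  rw [← hfg, LinearMap.lTensor_comp, LinearMap.comp_apply]

/-- Whether a presentation of `N` by a projective module stays injective after tensoring with `M`
does not depend on the presentation. -/
lemma lTensor_ker_injective_of_presentation {M N F Q : Type*} [AddCommGroup M] [Module R M]
    [AddCommGroup N] [Module R N] [AddCommGroup F] [Module R F] [AddCommGroup Q] [Module R Q]
    [Module.Projective R F] [Module.Projective R Q] {π : F →ₗ[R] N} {q : Q →ₗ[R] N}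
    (hπ : Function.Surjective π) (hq : Function.Surjective q)
    (h : Function.Injective ((LinearMap.ker π).subtype.lTensor M)) :
    Function.Injective ((LinearMap.ker q).subtype.lTensor M) := by
  obtain ⟨l, hl⟩ := Module.projective_lifting_property π q hπ
  obtain ⟨m, hm⟩ := Module.projective_lifting_property q π hq
  have hl' : ∀ y, π (l y) = q y := LinearMap.congr_fun hl
  have hm' : ∀ y, q (m y) = π y := LinearMap.congr_fun hm
  let l₁ : LinearMap.ker q →ₗ[R] LinearMap.ker π := l.restrict fun y hy => by
    simpa [hl'] using hy
  let m₁ : LinearMap.ker π →ₗ[R] LinearMap.ker q := m.restrict fun y hy => by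
    simpa [hm'] using hy
  let r : Q →ₗ[R] LinearMap.ker q := (LinearMap.id - m ∘ₗ l).codRestrict _ fun y => by
    simp [hl', hm']
  -- A homotopy: id - m ∘ l takes values in ker q. After tensoring, z is killed by the inclusion and
  -- by l₁, hence by the identity.
  have hid : m₁ ∘ₗ l₁ + r ∘ₗ (LinearMap.ker q).subtype = LinearMap.id := by
    ext y
    simp [m₁, l₁, r]
  rw [injective_iff_map_eq_zero]
  intro z hz
  have h1 : l₁.lTensor M z = 0 := by
    refine (injective_iff_map_eq_zero _).mp h _ ?_
    rw [lTensor_lTensor_of_comp_eq (f := l₁) (h := l ∘ₗ (LinearMap.ker q).subtype) rfl,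
      LinearMap.lTensor_comp, LinearMap.comp_apply, hz, map_zero]
  have h2 := LinearMap.congr_fun (congrArg (LinearMap.lTensor M) hid) z
  rw [LinearMap.lTensor_add, LinearMap.lTensor_comp, LinearMap.lTensor_comp, LinearMap.add_apply,
    LinearMap.comp_apply, LinearMap.comp_apply, hz, h1, LinearMap.lTensor_id] at h2
  simpa using h2.symm

open MonoidalCategory in
-- Tor is derived in its second variable, so it is computed from a chosen projective resolution of
-- N. Presentation independence carries the injectivity over to its first step.
lemma isZero_tor_one {M N F : Type u} [AddCommGroup M] [Module R M]
    [AddCommGroup N] [Module R N] [AddCommGroup F] [Module R F] [Module.Projective R F]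
    {π : F →ₗ[R] N} (hπ : Function.Surjective π)
    (h : Function.Injective ((LinearMap.ker π).subtype.lTensor M)) :
    Limits.IsZero (((Tor (ModuleCat.{u} R) 1).obj (ModuleCat.of R M)).obj (ModuleCat.of R N)) := by
  let Q := projectiveResolution (ModuleCat.of R N)
  refine Limits.IsZero.of_iso ?_ (Q.isoLeftDerivedObj ((tensoringLeft _).obj (ModuleCat.of R M)) 1)
  change Limits.IsZero (HomologicalComplex.homology _ 1)
  rw [← HomologicalComplex.exactAt_iff_isZero_homology,
    HomologicalComplex.exactAt_iff' _ 2 1 0 (by simp) (by simp),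
    ShortComplex.ShortExact.moduleCat_exact_iff_function_exact]
  let d₂ : Q.complex.X 2 →ₗ[R] Q.complex.X 1 := (Q.complex.d 2 1).hom
  let d₁ : Q.complex.X 1 →ₗ[R] Q.complex.X 0 := (Q.complex.d 1 0).hom
  let q : Q.complex.X 0 →ₗ[R] N := (Q.π.f 0).hom
  change Function.Exact (d₂.lTensor M) (d₁.lTensor M)
  have hq : Function.Surjective q := (ModuleCat.epi_iff_surjective (Q.π.f 0)).mp inferInstance
  have hex0 : Function.Exact d₁ q := by
    have := (ShortComplex.ShortExact.moduleCat_exact_iff_function_exact _).mp Q.exact₀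
    exact this
  have hex1 : Function.Exact d₂ d₁ := by
    have := (ShortComplex.ShortExact.moduleCat_exact_iff_function_exact _).mp (Q.exact_succ 0)
    exact this
  have : Module.Projective R (Q.complex.X 0) :=
    (IsProjective.iff_projective (R := R) (Q.complex.X 0)).mpr (Q.projective 0)
  have hinj := lTensor_ker_injective_of_presentation hπ hq h
  let d₁' : Q.complex.X 1 →ₗ[R] LinearMap.ker q :=
    d₁.codRestrict _ fun x => hex0.apply_apply_eq_zero x
  have hd₁' : Function.Surjective d₁' := by
    rintro ⟨x, hx⟩
    obtain ⟨y, hy⟩ := (hex0 x).mp hx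
    exact ⟨y, Subtype.ext hy⟩
  have hex1' : Function.Exact d₂ d₁' := by
    intro x
    rw [← hex1 x, Subtype.ext_iff]
    rfl
  have hT := lTensor_exact M hex1' hd₁'
  intro z
  rw [← hT z, ← lTensor_lTensor_of_comp_eq (f := d₁') (g := (LinearMap.ker q).subtype) (h := d₁) rfl,
    map_eq_zero_iff _ hinj]

/-- Exactness of `M ⊗ A → M ⊗ B → M ⊗ C` makes `Tor_1(M, coker(B → C))` vanish. -/
lemma isZero_tor_one_of_exact {M A B C : Type u} [AddCommGroup M] [Module R M]
    [AddCommGroup A] [Module R A] [AddCommGroup B] [Module R B] [AddCommGroup C] [Module R C]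
    [Module.Projective R C] {f : A →ₗ[R] B} {g : B →ₗ[R] C} (hfg : g ∘ₗ f = 0)
    (h : ∀ z, g.lTensor M z = 0 → ∃ w, f.lTensor M w = z) :
    Limits.IsZero (((Tor (ModuleCat.{u} R) 1).obj (ModuleCat.of R M)).obj
      (ModuleCat.of R (C ⧸ LinearMap.range g))) := by
  refine isZero_tor_one (Submodule.mkQ_surjective (LinearMap.range g)) ?_
  let g' : B →ₗ[R] LinearMap.ker (LinearMap.range g).mkQ := g.codRestrict _ fun x => by simp
  have hg' : Function.Surjective g' := by
    rintro ⟨x, hx⟩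
    rw [Submodule.ker_mkQ] at hx
    obtain ⟨y, rfl⟩ := hx
    exact ⟨y, rfl⟩
  rw [injective_iff_map_eq_zero]
  intro z hz
  obtain ⟨z, rfl⟩ := LinearMap.lTensor_surjective M hg' z
  rw [lTensor_lTensor_of_comp_eq (h := g) rfl] at hz
  obtain ⟨w, rfl⟩ := h z hz
  have : g' ∘ₗ f = 0 := by
    ext x
    exact LinearMap.congr_fun hfg x
  rw [lTensor_lTensor_of_comp_eq this, LinearMap.lTensor_zero, LinearMap.zero_apply]

lemma dualTensorHom_comm_lTensor_dualMap {M P Q : Type*} [AddCommGroup M] [Module R M]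
    [AddCommGroup P] [Module R P] [AddCommGroup Q] [Module R Q] (k : P →ₗ[R] Q)
    (t : M ⊗[R] Module.Dual R Q) :
    dualTensorHom R P M (TensorProduct.comm R _ _ (k.dualMap.lTensor M t)) =
      dualTensorHom R Q M (TensorProduct.comm R _ _ t) ∘ₗ k := by
  induction t using TensorProduct.induction_on with
  | zero => simp
  | tmul m φ => ext; simp
  | add a b ha hb => simp only [map_add, ha, hb, LinearMap.add_comp]

/-- If cochains with values in `M` are exact, then the corresponding dual complex is exact after
tensoring with `M`. -/
lemma exists_lTensor_dualMap {M A B C : Type*} [AddCommGroup M] [Module R M]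
    [AddCommGroup A] [Module R A] [AddCommGroup B] [Module R B] [AddCommGroup C] [Module R C]
    [Module.Projective R B] [Module.Finite R B] [Module.Projective R C] [Module.Finite R C]
    {f : A →ₗ[R] B} {g : B →ₗ[R] C}
    (h : ∀ φ : B →ₗ[R] M, φ ∘ₗ f = 0 → ∃ ψ : C →ₗ[R] M, ψ ∘ₗ g = φ)
    (z : M ⊗[R] Module.Dual R B) (hz : f.dualMap.lTensor M z = 0) :
    ∃ w, g.dualMap.lTensor M w = z := by
  have hz' := dualTensorHom_comm_lTensor_dualMap f z
  rw [hz, map_zero, map_zero] at hz'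
  obtain ⟨ψ, hψ⟩ := h _ hz'.symm
  obtain ⟨w, rfl⟩ := (dualTensorHom_bijective (R := R) (M := C) (N := M)).2 ψ
  obtain ⟨w, rfl⟩ := (TensorProduct.comm R M (Module.Dual R C)).surjective w
  refine ⟨w, (TensorProduct.comm R M (Module.Dual R B)).injective
    ((dualTensorHom_bijective (R := R) (M := B) (N := M)).1 ?_)⟩
  rw [dualTensorHom_comm_lTensor_dualMap, hψ]

/-- Symmetry of the vanishing of `Tor_1`. -/
lemma lTensor_injective_of_rTensor_injective {M' P M B F N : Type*} [AddCommGroup M']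
    [Module R M'] [AddCommGroup P] [Module R P] [AddCommGroup M] [Module R M] [AddCommGroup B]
    [Module R B] [AddCommGroup F] [Module R F] [AddCommGroup N] [Module R N] [Module.Flat R P]
    {i : M' →ₗ[R] P} {p : P →ₗ[R] M} (hip : Function.Exact i p) (hp : Function.Surjective p)
    {j : B →ₗ[R] F} {q : F →ₗ[R] N} (hjq : Function.Exact j q) (hj : Function.Injective j)
    (hq : Function.Surjective q) (h : Function.Injective (i.rTensor N)) :
    Function.Injective (j.lTensor M) := by
  rw [injective_iff_map_eq_zero]
  intro z hz
  obtain ⟨w, rfl⟩ := LinearMap.rTensor_surjective B hp z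
  rw [← LinearMap.comp_apply, LinearMap.lTensor_comp_rTensor, ← LinearMap.rTensor_comp_lTensor,
    LinearMap.comp_apply] at hz
  obtain ⟨v, hv⟩ := (rTensor_exact F hip hp _).mp hz
  have hv0 : q.lTensor M' v = 0 := by
    refine (injective_iff_map_eq_zero _).mp h _ ?_
    rw [← LinearMap.comp_apply, LinearMap.rTensor_comp_lTensor, ← LinearMap.lTensor_comp_rTensor,
      LinearMap.comp_apply, hv, ← LinearMap.comp_apply, ← LinearMap.lTensor_comp,
      hjq.linearMap_comp_eq_zero, LinearMap.lTensor_zero, LinearMap.zero_apply]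
  obtain ⟨t, rfl⟩ := (lTensor_exact M' hjq hq _).mp hv0
  rw [← LinearMap.comp_apply, LinearMap.rTensor_comp_lTensor, ← LinearMap.lTensor_comp_rTensor,
    LinearMap.comp_apply] at hv
  rw [← Module.Flat.lTensor_preserves_injective_linearMap (M := P) j hj hv,
    ← LinearMap.comp_apply, ← LinearMap.rTensor_comp, hip.linearMap_comp_eq_zero,
    LinearMap.rTensor_zero, LinearMap.zero_apply]

/-- High syzygies are Tor-independent of modules of finite projective dimension. -/
lemma lTensor_syzygy_injective {b : ℕ → ℕ}
    {d : ∀ i, (Fin (b (i + 1)) → R) →ₗ[R] (Fin (b i) → R)}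
    (hd : ∀ i, Function.Exact (d (i + 1)) (d i)) (n : ℕ) :
    ∀ (M : Type u) [AddCommGroup M] [Module R M],
      HasProjectiveDimensionLT (ModuleCat.of R M) (n + 1) →
      Function.Injective ((LinearMap.range (d n)).subtype.lTensor M) := by
  induction n with
  | zero =>
    intro M _ _ hM
    have := projective_of_hasProjectiveDimensionLT_one hM
    exact Module.Flat.lTensor_preserves_injective_linearMap _ (Submodule.subtype_injective _)
  | succ n ih =>
    intro M _ _ hM
    let π : (M →₀ R) →ₗ[R] M := Finsupp.linearCombination R id
    have hπ : Function.Surjective π := Finsupp.linearCombination_id_surjective R M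
    have hex : Function.Exact (LinearMap.ker π).subtype π := LinearMap.exact_subtype_ker_map π
    have h1 : HasProjectiveDimensionLT (ModuleCat.of R (M →₀ R)) 1 :=
      hasProjectiveDimensionLT_one_of_projective
    have hker : HasProjectiveDimensionLT (ModuleCat.of R (LinearMap.ker π)) (n + 1) :=
      (exactComplex_shortExact hex (Submodule.subtype_injective _) hπ).hasProjectiveDimensionLT_X₁
        (n + 1) (hasProjectiveDimensionLT_of_ge _ 1 _ (by omega)) hM
    have hinj := ih _ hker
    refine lTensor_injective_of_rTensor_injective (M' := LinearMap.ker π) (P := M →₀ R) hex hπ (exact_syzygy hd n)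
      (Submodule.subtype_injective _) (LinearMap.surjective_rangeRestrict _) ?_
    -- Followed by the map to Φ ⊗ F_n, with Φ the free cover of M, the map equals ker π ⊗ range (d
    -- n) → ker π ⊗ F_n → Φ ⊗ F_n, injective by induction and by flatness of F_n.
    refine Function.Injective.of_comp
      (f := (LinearMap.range (d n)).subtype.lTensor (M →₀ R)) ?_
    rw [← LinearMap.coe_comp, LinearMap.lTensor_comp_rTensor, ← LinearMap.rTensor_comp_lTensor,
      LinearMap.coe_comp]
    exact (Module.Flat.rTensor_preserves_injective_linearMap _
      (Submodule.subtype_injective _)).comp hinj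

end TorVanishing

/-! ### Strongly rigid modules of finite projective dimension -/

section StronglyRigid

variable {R : Type u} [CommRing R] {M : Type u} [AddCommGroup M] [Module R M]

lemma IsStronglyRigid.finitePd (hM : IsStronglyRigid R M) {N : Type u} [AddCommGroup N]
    [Module R N] [Module.Finite R N]
    (h : Limits.IsZero (((Tor (ModuleCat.{u} R) 1).obj (ModuleCat.of R M)).obj
      (ModuleCat.of R N))) : FinitePd R N := by
  obtain ⟨n, hn⟩ := (projectiveDimension_ne_top_iff _).mp (hM N 1 le_rfl h).ne
  exact ⟨n + 1, hn⟩

/-- If a strongly rigid module has finite projective dimension, then so has every finitely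
generated module. -/
lemma IsStronglyRigid.finitePd_of_finitePd [IsNoetherianRing R] (hM : IsStronglyRigid R M)
    (h : FinitePd R M) (Z : Type u) [AddCommGroup Z] [Module R Z] [Module.Finite R Z] :
    FinitePd R Z := by
  obtain ⟨n, hn⟩ := h
  obtain ⟨b, d, ε, hε, h0, hd⟩ := exists_free_resolution (R := R) Z
  refine finitePd_of_syzygy hd hε h0 n (hM.finitePd ?_)
  refine isZero_tor_one (LinearMap.surjective_rangeRestrict (d n)) ?_
  have hker : LinearMap.ker (d n).rangeRestrict = LinearMap.range (d (n + 1)) := by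
    rw [LinearMap.ker_rangeRestrict, LinearMap.exact_iff.mp (hd n)]
  rw [hker]
  exact lTensor_syzygy_injective hd (n + 1) M (hasProjectiveDimensionLT_of_ge _ n _ (by omega))

end StronglyRigid

/-! ### Depth through Ext of the residue field, and Auslander–Buchsbaum -/

section ResidueFieldExt

open IsLocalRing

variable {R : Type u} [CommRing R]

/-- In the top degree q the functor Ext^q(N, -) is right exact, so its vanishing on R passes to
every quotient of a finite free module. -/
lemma hasProjectiveDimensionLT_of_extZero_self [IsNoetherianRing R] {N : Type u} [AddCommGroup N]
    [Module R N] [Module.Finite R N] {q : ℕ}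
    (h : HasProjectiveDimensionLT (ModuleCat.of R N) (q + 1)) (hq : ExtZero R N R q) :
    HasProjectiveDimensionLT (ModuleCat.of R N) q := by
  refine hasProjectiveDimensionLT_of_extZero q fun L _ _ _ => ?_
  obtain ⟨b, π, hπ⟩ := Module.Finite.exists_fin' R L
  exact ExtZero.cov_right (LinearMap.exact_subtype_ker_map π) (Submodule.subtype_injective _) hπ
    (hq.pi_right b) (ExtZero.of_hasProjectiveDimensionLT h le_rfl)

variable [IsLocalRing R]

lemma smul_residueField_eq_zero {x : R} (hx : x ∈ maximalIdeal R) (y : ResidueField R) :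
    x • y = 0 := by
  rw [Algebra.smul_def, ResidueField.algebraMap_eq, (residue_eq_zero_iff x).mpr hx, zero_mul]

/-- In a prime filtration of E every prime contains a power of the maximal ideal, so every factor is
the residue field. -/
lemma ExtZero.of_pow_le_annihilator [IsNoetherianRing R] {V : Type u} [AddCommGroup V]
    [Module R V] {t : ℕ} (hk : ∀ i, i < t → ExtZero R (ResidueField R) V i) (a : ℕ)
    (E : Type u) [AddCommGroup E] [Module R E] [Module.Finite R E]
    (hE : maximalIdeal R ^ a ≤ Module.annihilator R E) : ∀ i, i < t → ExtZero R E V i := by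
  revert hE
  refine IsNoetherianRing.induction_on_isQuotientEquivQuotientPrime R (M := E) inferInstance
    (motive := fun E _ _ _ => maximalIdeal R ^ a ≤ Module.annihilator R E →
      ∀ i, i < t → ExtZero R E V i) ?_ ?_ ?_
  · intro N _ _ _ _ _ i _
    exact ExtZero.of_subsingleton_left
  · intro N _ _ _ p e hN i hi
    rw [e.annihilator_eq, Ideal.annihilator_quotient] at hN
    have hp : p.asIdeal = maximalIdeal R :=
      ((maximalIdeal.isMaximal R).eq_of_le p.2.ne_top (p.2.le_of_pow_le hN)).symm
    exact (hk i hi).congr_left (e.trans (Submodule.quotEquivOfEq _ _ hp))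
  · intro N₁ _ _ _ N₂ _ _ _ N₃ _ _ _ f g hf hg hfg h1 h3 h2 i hi
    exact ExtZero.contra_mid hfg hf hg
      (h1 (h2.trans (f.annihilator_le_of_injective hf)) i hi)
      (h3 (h2.trans (g.annihilator_le_of_surjective hg)) i hi)

/-- The least such t plays the role of depth R. If all Ext(k, R/W) vanish, vanishing in degree 0
gives x in the maximal ideal regular on R/W. Then all Ext(k, R/(W, x)) vanish too, and the strictly
larger proper ideal contradicts Noetherian induction. -/
lemma exists_not_extZero_residueField [IsNoetherianRing R] :
    ∃ t, ¬ ExtZero R (ResidueField R) R t := by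
  by_contra! h
  have key : ∀ W : Ideal R, W ≠ ⊤ → ¬ ∀ i, ExtZero R (ResidueField R) (R ⧸ W) i := by
    intro W
    induction W using WellFoundedGT.induction with
    | ind W ih =>
      intro hW hext
      have hsub : Subsingleton (ResidueField R →ₗ[R] R ⧸ W) :=
        subsingleton_of_forall_eq 0 (extZero_zero_iff.mp (hext 0))
      obtain ⟨x, hx, hreg⟩ := IsSMulRegular.subsingleton_linearMap_iff.mp hsub
      have hxm : x ∈ maximalIdeal R := by
        have := Module.mem_annihilator.mp hx 1
        rwa [Algebra.smul_def, mul_one, ResidueField.algebraMap_eq, residue_eq_zero_iff] at this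
      have hle : W ≤ W ⊔ Ideal.span {x} := le_sup_left
      have hne : W ⊔ Ideal.span {x} ≠ ⊤ := by
        refine ne_top_of_le_ne_top (maximalIdeal.isMaximal R).ne_top
          (sup_le (le_maximalIdeal hW) ?_)
        rwa [Ideal.span_singleton_le_iff_mem]
      have hlt : W < W ⊔ Ideal.span {x} := by
        refine lt_of_le_of_ne hle fun heq => ?_
        have hxW : x ∈ W := by
          rw [heq]
          exact Ideal.mem_sup_right (Ideal.mem_span_singleton_self x)
        have h1 : x • (1 : R ⧸ W) = x • (0 : R ⧸ W) := by
          rw [smul_zero, Algebra.smul_def, mul_one]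
          exact Ideal.Quotient.eq_zero_iff_mem.mpr hxW
        have := Ideal.Quotient.nontrivial_iff.mpr hW
        exact one_ne_zero (hreg h1)
      refine ih _ hlt hne fun i => ?_
      have hex : Function.Exact (x • (LinearMap.id : (R ⧸ W) →ₗ[R] (R ⧸ W)))
          (Submodule.factor hle) := by
        intro y
        obtain ⟨y, rfl⟩ := Submodule.Quotient.mk_surjective _ y
        rw [← Submodule.mkQ_apply, Submodule.factor_mk, Submodule.mkQ_apply,
          Submodule.Quotient.mk_eq_zero]
        constructor
        · intro hy
          obtain ⟨w, hw, z, hz, rfl⟩ := Submodule.mem_sup.mp hy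
          obtain ⟨c, rfl⟩ := Ideal.mem_span_singleton'.mp hz
          refine ⟨Submodule.Quotient.mk c, ?_⟩
          rw [LinearMap.smul_apply, LinearMap.id_apply, ← Submodule.Quotient.mk_smul, eq_comm,
            Submodule.mkQ_apply, Submodule.Quotient.eq]
          simpa [mul_comm] using hw
        · rintro ⟨c, hc⟩
          obtain ⟨c, rfl⟩ := Submodule.Quotient.mk_surjective _ c
          rw [LinearMap.smul_apply, LinearMap.id_apply, ← Submodule.Quotient.mk_smul, eq_comm,
            Submodule.mkQ_apply, Submodule.Quotient.eq] at hc
          have : y = (y - x • c) + c * x := by simp [mul_comm]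
          rw [this]
          exact Submodule.add_mem_sup hc (Ideal.mem_span_singleton'.mpr ⟨c, rfl⟩)
      exact ExtZero.cov_right hex hreg (Submodule.factor_surjective hle) (hext i) (hext (i + 1))
  exact key ⊥ bot_ne_top fun i => (h i).congr_right (Submodule.quotEquivOfEqBot ⊥ rfl)

lemma ext_residueField_comp_eq_zero {F : Type u} [AddCommGroup F] [Module R F] {w : F}
    (hw : w ∈ maximalIdeal R • (⊤ : Submodule R F)) {t : ℕ}
    (e : Ext (ModuleCat.of R (ResidueField R)) (ModuleCat.of R R) t) :
    e.comp (Ext.mk₀ (ModuleCat.ofHom (LinearMap.toSpanSingleton R F w))) (add_zero t) = 0 := by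
  induction hw using Submodule.smul_induction_on' with
  | smul x hx y hy =>
    have : ModuleCat.ofHom (LinearMap.toSpanSingleton R F (x • y)) =
        x • ModuleCat.ofHom (LinearMap.toSpanSingleton R F y) := by
      ext
      simp
    rw [this, Ext.mk₀_smul, Ext.comp_smul]
    exact ExtKill.of_smul_eq_zero (smul_residueField_eq_zero hx) t _
  | add x hx y hy h1 h2 =>
    have : ModuleCat.ofHom (LinearMap.toSpanSingleton R F (x + y)) =
        ModuleCat.ofHom (LinearMap.toSpanSingleton R F x) +
          ModuleCat.ofHom (LinearMap.toSpanSingleton R F y) := by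
      ext
      simp
    rw [this, Ext.mk₀_add, Ext.comp_add, h1, h2, add_zero]

open TensorProduct in
-- A map of finite free modules splits as soon as it is injective modulo the maximal ideal.
-- Otherwise some v with a unit coordinate maps to zero modulo that ideal.
lemma exists_coord_of_not_split {K F : Type u} [AddCommGroup K] [Module R K] [AddCommGroup F]
    [Module R F] [Module.Free R K] [Module.Finite R K] [Module.Free R F] [Module.Finite R F]
    (ι : K →ₗ[R] F) (h : ¬ ∃ r, r ∘ₗ ι = LinearMap.id) :
    ∃ (v : K) (l : K →ₗ[R] R), l v = 1 ∧ ι v ∈ maximalIdeal R • (⊤ : Submodule R F) := by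
  rw [split_injective_iff_lTensor_residueField_injective, injective_iff_map_eq_zero] at h
  push Not at h
  obtain ⟨z, hz, hz0⟩ := h
  obtain ⟨v, rfl⟩ : ∃ v : K, (1 : ResidueField R) ⊗ₜ[R] v = z :=
    TensorProduct.mk_surjective R K (ResidueField R) (residue_surjective) z
  have hv : ∃ i, (Module.Free.chooseBasis R K).repr v i ∉ maximalIdeal R := by
    by_contra! hall
    refine hz0 ?_
    rw [← (Module.Free.chooseBasis R K).sum_repr v, TensorProduct.tmul_sum]
    refine Finset.sum_eq_zero fun i _ => ?_
    rw [TensorProduct.tmul_smul, TensorProduct.smul_tmul', smul_residueField_eq_zero (hall i),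
      TensorProduct.zero_tmul]
  obtain ⟨i, hi⟩ := hv
  obtain ⟨c, hc⟩ := (notMem_maximalIdeal.mp hi).exists_left_inv
  refine ⟨v, c • (Module.Free.chooseBasis R K).coord i, by simpa using hc, ?_⟩
  rw [← (Module.Free.chooseBasis R F).sum_repr (ι v)]
  refine Submodule.sum_mem _ fun j _ => Submodule.smul_mem_smul ?_ trivial
  rw [LinearMap.lTensor_tmul] at hz
  have := congrArg (TensorProduct.rid R (ResidueField R) ∘
    ((Module.Free.chooseBasis R F).coord j).lTensor (ResidueField R)) hz
  simp only [Function.comp_apply, LinearMap.lTensor_tmul, Module.Basis.coord_apply,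
    TensorProduct.rid_tmul, map_zero] at this
  rwa [Algebra.smul_def, mul_one, ResidueField.algebraMap_eq, residue_eq_zero_iff] at this

/-- The formula of Auslander and Buchsbaum, in the form that is used. -/
lemma not_extZero_of_projectiveDimension [IsNoetherianRing R] {t : ℕ}
    (ht : ∀ i, i < t → ExtZero R (ResidueField R) R i) (ht' : ¬ ExtZero R (ResidueField R) R t)
    (q : ℕ) : ∀ (N : Type u) [AddCommGroup N] [Module R N] [Module.Finite R N],
      HasProjectiveDimensionLT (ModuleCat.of R N) (q + 2) →
      ¬ HasProjectiveDimensionLT (ModuleCat.of R N) (q + 1) →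
      q + 1 ≤ t ∧ ¬ ExtZero R (ResidueField R) N (t - (q + 1)) := by
  induction q with
  | zero =>
    intro N _ _ _ h2 h1
    obtain ⟨b, π, hπ⟩ := Module.Finite.exists_fin' R N
    have hex : Function.Exact (LinearMap.ker π).subtype π := LinearMap.exact_subtype_ker_map π
    have hS := exactComplex_shortExact hex (Submodule.subtype_injective _) hπ
    have hF : HasProjectiveDimensionLT (ModuleCat.of R (Fin b → R)) 1 :=
      hasProjectiveDimensionLT_one_of_projective
    have := projective_of_hasProjectiveDimensionLT_one (hS.hasProjectiveDimensionLT_X₁ 1 hF h2)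
    have hfree : Module.Free R (LinearMap.ker π) := Module.free_of_flat_of_isLocalRing
    have hns : ¬ ∃ r, r ∘ₗ (LinearMap.ker π).subtype = LinearMap.id := by
      rintro ⟨r, hr⟩
      refine h1 (hasProjectiveDimensionLT_of_extZero 1 fun L _ _ _ => ?_)
      refine ExtZero.one_of_extend hex (Submodule.subtype_injective _) hπ
        (ExtZero.of_projective le_rfl) fun φ => ⟨φ ∘ₗ r, ?_⟩
      rw [LinearMap.comp_assoc, hr, LinearMap.comp_id]
    obtain ⟨v, l, hlv, hv⟩ := exists_coord_of_not_split _ hns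
    simp only [ExtZero, not_forall] at ht'
    obtain ⟨e, he⟩ := ht'
    -- Pushing e along v keeps it nonzero, since l v = 1, but kills its image in Ext^t(k, F). For t
    -- > 0 it therefore comes from Ext^{t-1}(k, N); for t = 0 it contradicts injectivity of K → F.
    set e₁ := e.comp (Ext.mk₀ (ModuleCat.ofHom (LinearMap.toSpanSingleton R _ v))) (add_zero t)
    have he₁ : e₁ ≠ 0 := by
      intro h0
      apply he
      have h3 : ModuleCat.ofHom (LinearMap.toSpanSingleton R _ v) ≫ ModuleCat.ofHom l =
          𝟙 (ModuleCat.of R R) := by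
        ext
        simp [hlv]
      rw [← e.comp_mk₀_id, ← h3, ← Ext.mk₀_comp_mk₀, ← Ext.comp_assoc_of_third_deg_zero]
      change e₁.comp _ _ = 0
      rw [h0, Ext.zero_comp]
    have he₂ : e₁.comp (Ext.mk₀ (ModuleCat.ofHom (LinearMap.ker π).subtype)) (add_zero t) = 0 := by
      rw [Ext.comp_assoc_of_third_deg_zero, Ext.mk₀_comp_mk₀]
      have h3 : ModuleCat.ofHom (LinearMap.toSpanSingleton R _ v) ≫
          ModuleCat.ofHom (LinearMap.ker π).subtype =
          ModuleCat.ofHom (LinearMap.toSpanSingleton R _ ((LinearMap.ker π).subtype v)) := by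
        ext
        simp
      rw [h3]
      exact ext_residueField_comp_eq_zero hv e
    have ht0 : 0 < t := by
      by_contra! hle
      obtain rfl : t = 0 := by omega
      have hmono : Mono (ModuleCat.ofHom (LinearMap.ker π).subtype) := hS.mono_f
      refine he₁ (Ext.postcomp_mk₀_injective_of_mono _
        (ModuleCat.ofHom (LinearMap.ker π).subtype) ?_)
      simpa using he₂
    refine ⟨ht0, fun hN => ?_⟩
    obtain ⟨x, hx⟩ := Ext.covariant_sequence_exact₁ _ hS e₁ he₂
      (show (t - (0 + 1)) + 1 = t by omega)
    rw [hN x, Ext.zero_comp] at hx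
    exact he₁ hx.symm
  | succ q ih =>
    intro N _ _ _ h2 h1
    obtain ⟨b, π, hπ⟩ := Module.Finite.exists_fin' R N
    have hex : Function.Exact (LinearMap.ker π).subtype π := LinearMap.exact_subtype_ker_map π
    have hS := exactComplex_shortExact hex (Submodule.subtype_injective _) hπ
    have hF : HasProjectiveDimensionLT (ModuleCat.of R (Fin b → R)) 1 :=
      hasProjectiveDimensionLT_one_of_projective
    have hext : ∀ i, i < t → ExtZero R (ResidueField R) (Fin b → R) i :=
      fun i hi => (ht i hi).pi_right b
    obtain ⟨hq, hK⟩ := ih (LinearMap.ker π)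
      (hS.hasProjectiveDimensionLT_X₁ (q + 2) (hasProjectiveDimensionLT_of_ge _ 1 _ (by omega)) h2)
      (fun h => h1 (hS.hasProjectiveDimensionLT_X₃ (q + 1) h
        (hasProjectiveDimensionLT_of_ge _ 1 _ (by omega))))
    obtain rfl | hlt := hq.eq_or_lt
    · exfalso
      apply hK
      rw [Nat.sub_self, extZero_zero_iff]
      intro f
      have := extZero_zero_iff.mp (hext 0 (by omega)) ((LinearMap.ker π).subtype ∘ₗ f)
      ext x
      simpa using congrFun (LinearMap.congr_fun this x) _
    · refine ⟨hlt, fun hN => hK ?_⟩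
      have hs : t - (q + 1) = (t - (q + 1 + 1)) + 1 := by omega
      rw [hs]
      exact ExtZero.cov_left hex (Submodule.subtype_injective _) hπ hN (hext _ (by omega))

/-- If the projective dimension were q + 1 ≥ 1, then q + 1 ≤ t by Auslander–Buchsbaum, and vanishing
of Ext^{q+1}(N, R) would lower it. -/
lemma FinitePd.projective [IsNoetherianRing R] {t : ℕ}
    (ht : ∀ i, i < t → ExtZero R (ResidueField R) R i) (ht' : ¬ ExtZero R (ResidueField R) R t)
    {N : Type u} [AddCommGroup N] [Module R N] [Module.Finite R N] (hN : FinitePd R N)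
    (hext : ∀ j, j + 1 ≤ t → ExtZero R N R (j + 1)) : Module.Projective R N := by
  classical
  apply projective_of_hasProjectiveDimensionLT_one
  have hspec := Nat.find_spec hN
  have hmin := fun {m} => Nat.find_min hN (m := m)
  generalize Nat.find hN = p at hspec hmin
  obtain hp | ⟨q, rfl⟩ : p ≤ 1 ∨ ∃ q, p = q + 2 := by
    obtain _ | _ | q := p
    · simp
    · simp
    · exact Or.inr ⟨q, rfl⟩
  · exact hasProjectiveDimensionLT_of_ge _ p _ hp
  · obtain ⟨hq, -⟩ := not_extZero_of_projectiveDimension ht ht' q N hspec (hmin (by omega))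
    exact absurd (hasProjectiveDimensionLT_of_extZero_self hspec (hext q hq)) (hmin (by omega))

end ResidueFieldExt

/-! ### Cokernels in the dual of a free resolution -/

section Transpose

variable {R : Type u} [CommRing R]

/-- The cokernel of the dual of a linear map: the transpose of the cokernel of the map. -/
abbrev DualCoker {A B : Type u} [AddCommGroup A] [Module R A] [AddCommGroup B] [Module R B]
    (f : A →ₗ[R] B) : Type u :=
  Module.Dual R A ⧸ LinearMap.range f.dualMap

variable {A B C : Type u} [AddCommGroup A] [Module R A] [AddCommGroup B] [Module R B]
  [AddCommGroup C] [Module R C]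

/-- The map induced by `g.dualMap` on the cokernel of `f.dualMap`. -/
def dualCokerMap {f : B →ₗ[R] A} {g : C →ₗ[R] B} (h : Function.Exact g f) :
    DualCoker f →ₗ[R] Module.Dual R C :=
  (LinearMap.range f.dualMap).liftQ g.dualMap (by
    rintro _ ⟨φ, rfl⟩
    ext x
    simp [h.apply_apply_eq_zero])

lemma dualCokerMap_mk {f : B →ₗ[R] A} {g : C →ₗ[R] B} (h : Function.Exact g f)
    (φ : Module.Dual R B) :
    dualCokerMap h (Submodule.Quotient.mk φ) = φ ∘ₗ g := rfl

lemma range_dualCokerMap {f : B →ₗ[R] A} {g : C →ₗ[R] B} (h : Function.Exact g f) :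
    LinearMap.range (dualCokerMap h) = LinearMap.range g.dualMap :=
  Submodule.range_liftQ _ _ _

/-- A functional on the image of g* pulls back to B*, where by reflexivity it is evaluation at some
z. It kills g* ∘ f* = 0, so f z = 0 and z = g w; evaluation at w is the required extension to C*. -/
lemma extZero_dualCoker_one {f : B →ₗ[R] A} {g : C →ₗ[R] B} (h : Function.Exact g f)
    [Module.Free R A] [Module.Free R B] [Module.Finite R B] [Module.Free R C]
    [Module.Finite R C] : ExtZero R (DualCoker g) R 1 := by
  have hex : Function.Exact (LinearMap.range g.dualMap).subtype
      (LinearMap.range g.dualMap).mkQ := by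
    rw [LinearMap.exact_iff, Submodule.ker_mkQ, Submodule.range_subtype]
  refine ExtZero.one_of_extend hex (Submodule.subtype_injective _)
    (Submodule.mkQ_surjective _) (ExtZero.of_projective le_rfl) fun φ => ?_
  obtain ⟨z, hz⟩ := (Module.evalEquiv R B).surjective (φ ∘ₗ g.dualMap.rangeRestrict)
  have hz' : ∀ ξ : Module.Dual R B, φ (g.dualMap.rangeRestrict ξ) = ξ z := fun ξ =>
    (LinearMap.congr_fun hz ξ).symm
  have hfz : f z = 0 := by
    rw [← Module.forall_dual_apply_eq_zero_iff R]
    intro ξ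
    have h1 := hz' (ξ ∘ₗ f)
    have h2 : g.dualMap.rangeRestrict (ξ ∘ₗ f) = 0 := by
      ext x
      simp [h.apply_apply_eq_zero]
    rw [h2, map_zero] at h1
    exact h1.symm
  obtain ⟨w, rfl⟩ := (h z).mp hfz
  refine ⟨Module.Dual.eval R C w, ?_⟩
  ext ⟨_, ξ, rfl⟩
  exact (hz' ξ).symm

/-- Shift along 0 → H → coker f* → C* → coker g* → 0, where H is the cohomology of the dual complex
at B*. -/
lemma extZero_dualCoker_succ {f : B →ₗ[R] A} {g : C →ₗ[R] B} (h : Function.Exact g f)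
    [Module.Free R C] [Module.Finite R C] {j : ℕ} (h1 : ExtZero R (DualCoker f) R (j + 1))
    (h2 : ExtZero R (LinearMap.ker (dualCokerMap h)) R j) :
    ExtZero R (DualCoker g) R (j + 2) := by
  have hex : Function.Exact (LinearMap.range (dualCokerMap h)).subtype
      (LinearMap.range g.dualMap).mkQ := by
    rw [LinearMap.exact_iff, Submodule.ker_mkQ, Submodule.range_subtype, range_dualCokerMap]
  refine ExtZero.contra_right hex (Submodule.subtype_injective _) (Submodule.mkQ_surjective _) ?_
    (ExtZero.of_projective (by omega))
  have hex' : Function.Exact (LinearMap.ker (dualCokerMap h)).subtype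
      (dualCokerMap h).rangeRestrict := by
    rw [LinearMap.exact_iff, LinearMap.ker_rangeRestrict, Submodule.range_subtype]
  exact ExtZero.contra_right hex' (Submodule.subtype_injective _)
    (LinearMap.surjective_rangeRestrict _) h2 h1

/-- Splitting B* → coker f* and then A* → im f* gives h with f* h f* = f*. Its transpose h'
satisfies f h' f = f, so im f is a direct summand of A. -/
lemma projective_range_of_projective_dualCoker (f : B →ₗ[R] A) [Module.Free R A]
    [Module.Finite R A] [Module.Free R B] [Module.Finite R B]
    (hN : Module.Projective R (DualCoker f)) : Module.Projective R (LinearMap.range f) := by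
  obtain ⟨s, hs⟩ := Module.projective_lifting_property (LinearMap.range f.dualMap).mkQ
    LinearMap.id (Submodule.mkQ_surjective _)
  let ρ : Module.Dual R B →ₗ[R] LinearMap.range f.dualMap :=
    (LinearMap.id - s ∘ₗ (LinearMap.range f.dualMap).mkQ).codRestrict _ fun x => by
      have hx : (LinearMap.range f.dualMap).mkQ
          ((LinearMap.id - s ∘ₗ (LinearMap.range f.dualMap).mkQ : _ →ₗ[R] _) x) = 0 := by
        rw [LinearMap.sub_apply, map_sub, sub_eq_zero]
        exact (LinearMap.congr_fun hs _).symm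
      exact (Submodule.Quotient.mk_eq_zero _).mp hx
  have hρ : ∀ x : LinearMap.range f.dualMap, ρ x = x := fun x => by
    have hx : (LinearMap.range f.dualMap).mkQ x.1 = 0 := by simp
    ext1
    simp only [ρ, LinearMap.codRestrict_apply, LinearMap.sub_apply, LinearMap.comp_apply, hx,
      map_zero, sub_zero, LinearMap.id_apply]
  have : Module.Projective R (LinearMap.range f.dualMap) :=
    Module.Projective.of_split (LinearMap.range f.dualMap).subtype ρ (LinearMap.ext hρ)
  obtain ⟨σ, hσ⟩ := Module.projective_lifting_property f.dualMap.rangeRestrict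
    LinearMap.id (LinearMap.surjective_rangeRestrict _)
  let h : Module.Dual R B →ₗ[R] Module.Dual R A := σ ∘ₗ ρ
  have hh : ∀ ξ, (h (ξ ∘ₗ f)) ∘ₗ f = ξ ∘ₗ f := by
    intro ξ
    have h1 : ρ (ξ ∘ₗ f) = f.dualMap.rangeRestrict ξ := hρ (f.dualMap.rangeRestrict ξ)
    have h2 := LinearMap.congr_fun hσ (f.dualMap.rangeRestrict ξ)
    change f.dualMap (σ (ρ (ξ ∘ₗ f))) = f.dualMap ξ
    rw [h1]
    exact congrArg Subtype.val h2
  let h' : A →ₗ[R] B := (Module.evalEquiv R B).symm.toLinearMap ∘ₗ h.dualMap ∘ₗ Module.Dual.eval R A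
  have hh' : ∀ (η : Module.Dual R B) (y : A), η (h' y) = h η y := fun η y => by
    have h1 := LinearMap.congr_fun
      ((Module.evalEquiv R B).apply_symm_apply (h.dualMap (Module.Dual.eval R A y))) η
    exact h1
  have hff : ∀ x, f (h' (f x)) = f x := fun x => by
    rw [← sub_eq_zero, ← Module.forall_dual_apply_eq_zero_iff R]
    intro ξ
    rw [map_sub, sub_eq_zero]
    exact (hh' (ξ ∘ₗ f) (f x)).trans (LinearMap.congr_fun (hh ξ) x)
  refine Module.Projective.of_split (LinearMap.range f).subtype (f.rangeRestrict ∘ₗ h') ?_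
  ext ⟨_, x, rfl⟩
  exact hff x

end Transpose

/-! ### Strong rigidity and finite projective dimension of M -/

section Main

open IsLocalRing

variable {R : Type u} [CommRing R] [IsLocalRing R] [IsNoetherianRing R]

/-- A strongly rigid module without higher self-extensions has finite projective dimension. -/
lemma IsStronglyRigid.finitePd_self {M : Type u} [AddCommGroup M] [Module R M] [Module.Finite R M]
    (hM : IsStronglyRigid R M) {n : ℕ} (hn : ∀ j, n < j → ExtZero R M M j) : FinitePd R M := by
  classical
  obtain ⟨s, hs⟩ := (maximalIdeal R).fg_of_isNoetherianRing
  obtain ⟨Y, _, _, _, hYM, hkill, hpd⟩ := exists_extKill_list hn s.toList fun x hx => by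
    rw [← hs]
    exact Ideal.subset_span (Finset.mem_toList.mp hx)
  apply hpd
  obtain ⟨b, d, ε, hε, h0, hd⟩ := exists_free_resolution (R := R) Y
  have ht := Nat.find_spec (exists_not_extZero_residueField (R := R))
  have hmin : ∀ i, i < Nat.find (exists_not_extZero_residueField (R := R)) →
      ExtZero R (ResidueField R) R i := fun i hi => not_not.mp (Nat.find_min _ hi)
  generalize Nat.find (exists_not_extZero_residueField (R := R)) = t at ht hmin
  -- This kernel is the cohomology of the dual complex in degree i + 2, that is Ext^{i+2}(Y, R).
  -- Powers of the generators kill it, hence so does a power of the maximal ideal.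
  have hE : ∀ i j, j < t → ExtZero R (LinearMap.ker (dualCokerMap (hd (i + 1)))) R j := by
    intro i
    have hrad : maximalIdeal R ≤
        (Module.annihilator R (LinearMap.ker (dualCokerMap (hd (i + 1))))).radical := by
      rw [← hs, Ideal.span_le]
      intro x hx
      obtain ⟨a, ha⟩ := hkill x (Finset.mem_toList.mpr hx)
      refine ⟨a, Module.mem_annihilator.mpr ?_⟩
      rintro ⟨z, hz⟩
      obtain ⟨φ, rfl⟩ := Submodule.Quotient.mk_surjective _ z
      rw [LinearMap.mem_ker, dualCokerMap_mk] at hz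
      obtain ⟨ψ, hψ⟩ := exists_coboundary hd hε h0 i (ha R (i + 2) (by omega)) φ hz
      ext1
      change x ^ a • Submodule.Quotient.mk φ = (0 : DualCoker (d (i + 1)))
      rw [← Submodule.Quotient.mk_smul, Submodule.Quotient.mk_eq_zero]
      exact ⟨ψ, hψ⟩
    obtain ⟨a, ha⟩ := Ideal.exists_pow_le_of_le_radical_of_fg hrad
      (maximalIdeal R).fg_of_isNoetherianRing
    exact ExtZero.of_pow_le_annihilator hmin a _ ha
  -- Each increase of j moves one place back in the dual complex, whence the margin j + 1 ≤ i.
  have hext : ∀ j, j + 1 ≤ t → ∀ i, j + 1 ≤ i → ExtZero R (DualCoker (d i)) R (j + 1) := by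
    intro j
    induction j with
    | zero =>
      intro _ i hi
      obtain ⟨i, rfl⟩ := Nat.exists_eq_add_of_le' hi
      exact extZero_dualCoker_one (hd i)
    | succ j ih =>
      intro hj i hi
      obtain ⟨i, rfl⟩ := Nat.exists_eq_add_of_le' (show 2 ≤ i by omega)
      exact extZero_dualCoker_succ (hd (i + 1)) (ih (by omega) (i + 1) (by omega))
        (hE i j (by omega))
  -- The index exceeds n, so that Ext^{n+t+2}(Y, M) = 0 gives exactness, and exceeds t, so that
  -- `hext` covers all degrees from 1 to t.
  have hN : FinitePd R (DualCoker (d (n + t + 2))) := by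
    refine hM.finitePd (isZero_tor_one_of_exact (M := M)
      (f := (d (n + t + 1)).dualMap) (g := (d (n + t + 2)).dualMap) ?_ ?_)
    · ext φ x
      simp [(hd (n + t + 1)).apply_apply_eq_zero]
    · refine exists_lTensor_dualMap fun φ hφ => ?_
      obtain ⟨ψ, hψ⟩ := exists_coboundary (c := 1) hd hε h0 (n + t)
        (fun e => by rw [hYM _ (by omega) e, smul_zero]) φ hφ
      exact ⟨ψ, by rw [hψ, one_smul]⟩
  have hproj := hN.projective hmin ht fun j hj => hext j hj _ (by omega)
  refine finitePd_of_syzygy hd hε h0 (n + t + 2) ⟨1, ?_⟩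
  have := projective_range_of_projective_dualCoker _ hproj
  exact hasProjectiveDimensionLT_one_of_projective

end Main

/-! ### Projective dimension modulo a regular element -/

section ChangeOfRings

open TensorProduct

variable {R : Type u} [CommRing R] {x : R}

lemma baseChange_quotient_injective {K F N : Type u} [AddCommGroup K] [Module R K]
    [AddCommGroup F] [Module R F] [AddCommGroup N] [Module R N] {f : K →ₗ[R] F} {g : F →ₗ[R] N}
    (h : Function.Exact f g) (hf : Function.Injective f) (hx : IsSMulRegular N x) :
    Function.Injective (f.baseChange (R ⧸ Ideal.span {x})) := by
  rw [injective_iff_map_eq_zero]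
  intro z hz
  obtain ⟨y, rfl⟩ := (QuotSMulTop.equivQuotTensor x K).surjective z
  obtain ⟨y, rfl⟩ := Submodule.Quotient.mk_surjective _ y
  have h0 : Function.Exact (0 : PUnit.{u + 1} →ₗ[R] K) f :=
    fun a => ⟨fun ha => ⟨0, by rw [map_zero, hf (ha.trans (map_zero f).symm)]⟩,
      by rintro ⟨_, rfl⟩; simp⟩
  have hz' : f.lTensor (R ⧸ Ideal.span {x})
      (QuotSMulTop.equivQuotTensor x K (Submodule.Quotient.mk y)) = 0 := hz
  rw [← QuotSMulTop.equivQuotTensor_naturality_mk, LinearEquiv.map_eq_zero_iff] at hz'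
  obtain ⟨w, hw⟩ := (QuotSMulTop.map_first_exact_on_four_term_exact_of_isSMulRegular_last
    h0 h hx _).mp hz'
  rw [map_zero, LinearMap.zero_apply] at hw
  rw [← hw, map_zero]

lemma hasProjectiveDimensionLT_baseChange_quotient_succ {K F N : Type u} [AddCommGroup K]
    [Module R K] [AddCommGroup F] [Module R F] [Module.Projective R F] [AddCommGroup N]
    [Module R N] {f : K →ₗ[R] F} {g : F →ₗ[R] N} (h : Function.Exact f g)
    (hf : Function.Injective f) (hg : Function.Surjective g) (hx : IsSMulRegular N x) {p : ℕ}
    (hK : HasProjectiveDimensionLT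
      (ModuleCat.of (R ⧸ Ideal.span {x}) ((R ⧸ Ideal.span {x}) ⊗[R] K)) (p + 1)) :
    HasProjectiveDimensionLT
      (ModuleCat.of (R ⧸ Ideal.span {x}) ((R ⧸ Ideal.span {x}) ⊗[R] N)) (p + 2) := by
  have hex : Function.Exact (f.baseChange (R ⧸ Ideal.span {x}))
      (g.baseChange (R ⧸ Ideal.span {x})) := by
    intro y
    exact lTensor_exact (R ⧸ Ideal.span {x}) h hg y
  have hsurj : Function.Surjective (g.baseChange (R ⧸ Ideal.span {x})) :=
    fun y => LinearMap.lTensor_surjective (R ⧸ Ideal.span {x}) hg y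
  have hF : HasProjectiveDimensionLT
      (ModuleCat.of (R ⧸ Ideal.span {x}) ((R ⧸ Ideal.span {x}) ⊗[R] F)) 1 :=
    hasProjectiveDimensionLT_one_of_projective
  exact (exactComplex_shortExact hex (baseChange_quotient_injective h hf hx)
    hsurj).hasProjectiveDimensionLT_X₃ (p + 1) hK (hasProjectiveDimensionLT_of_ge _ 1 _ (by omega))

/-- Regularity of x on N keeps a free cover sequence exact modulo x. The syzygy lies in a free
module, so x is regular on it as well and the induction continues. -/
lemma hasProjectiveDimensionLT_baseChange_quotient (hxR : IsSMulRegular R x) (p : ℕ) :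
    ∀ (N : Type u) [AddCommGroup N] [Module R N], IsSMulRegular N x →
      HasProjectiveDimensionLT (ModuleCat.of R N) (p + 1) →
      HasProjectiveDimensionLT (ModuleCat.of (R ⧸ Ideal.span {x}) ((R ⧸ Ideal.span {x}) ⊗[R] N))
        (p + 1) := by
  induction p with
  | zero =>
    intro N _ _ _ h
    have := projective_of_hasProjectiveDimensionLT_one h
    exact hasProjectiveDimensionLT_one_of_projective
  | succ p ih =>
    intro N _ _ hxN h
    let π : (N →₀ R) →ₗ[R] N := Finsupp.linearCombination R id
    have hπ : Function.Surjective π := Finsupp.linearCombination_id_surjective R N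
    have hex : Function.Exact (LinearMap.ker π).subtype π := LinearMap.exact_subtype_ker_map π
    have hF : HasProjectiveDimensionLT (ModuleCat.of R (N →₀ R)) 1 :=
      hasProjectiveDimensionLT_one_of_projective
    have hι := Submodule.subtype_injective (LinearMap.ker π)
    have hK := ih (LinearMap.ker π)
      (fun a b hab => hι <| Finsupp.ext fun i => hxR (DFunLike.congr_fun (congrArg Subtype.val hab) i))
      ((exactComplex_shortExact hex hι hπ).hasProjectiveDimensionLT_X₁ (p + 1)
        (hasProjectiveDimensionLT_of_ge _ 1 _ (by omega)) h)
    exact hasProjectiveDimensionLT_baseChange_quotient_succ (K := LinearMap.ker π)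
      (f := (LinearMap.ker π).subtype) hex hι hπ hxN hK

end ChangeOfRings

/-! ### Serre's criterion for regularity -/

section Serre

open IsLocalRing TensorProduct

variable {R : Type u} [CommRing R] [IsLocalRing R]

/-- The section sends 1 to 1 ⊗ x; it is well defined because r • x = x • r is zero modulo x for r in
the maximal ideal. The retraction comes from a functional on the cotangent space that is 1 at the
nonzero class of x. -/
lemma exists_retract_residueField {x : R} (hx : x ∈ maximalIdeal R) (hx2 : x ∉ maximalIdeal R ^ 2)
    [IsLocalRing (R ⧸ Ideal.span {x})] :
    ∃ (a : ResidueField (R ⧸ Ideal.span {x}) →ₗ[R ⧸ Ideal.span {x}]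
        (R ⧸ Ideal.span {x}) ⊗[R] maximalIdeal R)
      (b : (R ⧸ Ideal.span {x}) ⊗[R] maximalIdeal R →ₗ[R ⧸ Ideal.span {x}]
        ResidueField (R ⧸ Ideal.span {x})), ∀ y, b (a y) = y := by
  have hloc : IsLocalHom (algebraMap R (R ⧸ Ideal.span {x})) :=
    IsLocalHom.of_surjective _ Ideal.Quotient.mk_surjective
  let X : maximalIdeal R := ⟨x, hx⟩
  have hX : (maximalIdeal R).toCotangent X ≠ 0 := fun h0 =>
    hx2 ((Ideal.toCotangent_eq_zero _ X).mp h0)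
  obtain ⟨f, hf⟩ := Module.Projective.exists_dual_eq_one (ResidueField R)
    (V := CotangentSpace R) hX
  let φ : maximalIdeal R →ₗ[R] ResidueField (R ⧸ Ideal.span {x}) :=
    (Algebra.linearMap (ResidueField R) (ResidueField (R ⧸ Ideal.span {x}))).restrictScalars R ∘ₗ
      f.restrictScalars R ∘ₗ (maximalIdeal R).toCotangent
  have hφ : φ X = 1 := by
    change algebraMap _ _ (f ((maximalIdeal R).toCotangent X)) = 1
    rw [hf, map_one]
  refine ⟨(maximalIdeal (R ⧸ Ideal.span {x})).liftQ
    (LinearMap.toSpanSingleton _ _ (1 ⊗ₜ[R] X)) ?_, LinearMap.liftBaseChange _ φ, ?_⟩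
  · intro s hs
    obtain ⟨r, rfl⟩ := Ideal.Quotient.mk_surjective s
    have hr : r ∈ maximalIdeal R := by
      rw [mem_maximalIdeal, mem_nonunits_iff] at hs ⊢
      exact fun h => hs (h.map _)
    have h1 : r • X = x • (⟨r, hr⟩ : maximalIdeal R) := Subtype.ext (mul_comm _ _)
    rw [LinearMap.mem_ker, LinearMap.toSpanSingleton_apply]
    change (algebraMap R (R ⧸ Ideal.span {x}) r) • (1 ⊗ₜ[R] X) = 0
    rw [algebraMap_smul, ← TensorProduct.tmul_smul, h1, TensorProduct.tmul_smul,
      ← algebraMap_smul (R ⧸ Ideal.span {x}) x, Ideal.Quotient.algebraMap_eq,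
      Ideal.Quotient.eq_zero_iff_mem.mpr (Ideal.mem_span_singleton_self x), zero_smul]
  · intro y
    obtain ⟨s, rfl⟩ := residue_surjective y
    change LinearMap.liftBaseChange _ φ (s • ((1 : R ⧸ Ideal.span {x}) ⊗ₜ[R] X)) = _
    rw [map_smul, LinearMap.liftBaseChange_tmul, one_smul, hφ, Algebra.smul_def, mul_one]
    rfl

lemma finitePd_residueField_quotient (hk : FinitePd R (ResidueField R)) {x : R}
    (hx : x ∈ maximalIdeal R) (hx2 : x ∉ maximalIdeal R ^ 2) (hreg : IsSMulRegular R x)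
    [IsLocalRing (R ⧸ Ideal.span {x})] :
    FinitePd (R ⧸ Ideal.span {x}) (ResidueField (R ⧸ Ideal.span {x})) := by
  obtain ⟨n, hn⟩ := hk
  have hex : Function.Exact (maximalIdeal R).subtype (Algebra.linearMap R (ResidueField R)) := by
    intro r
    rw [Algebra.linearMap_apply, ResidueField.algebraMap_eq, residue_eq_zero_iff]
    simp
  have hR : HasProjectiveDimensionLT (ModuleCat.of R R) 1 :=
    hasProjectiveDimensionLT_one_of_projective
  have h1 := (exactComplex_shortExact hex (Submodule.subtype_injective _)
    residue_surjective).hasProjectiveDimensionLT_X₁ (n + 1)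
      (hasProjectiveDimensionLT_of_ge _ 1 _ (by omega))
      (hasProjectiveDimensionLT_of_ge _ n _ (by omega))
  obtain ⟨a, b, hab⟩ := exists_retract_residueField hx hx2
  have h2 := hasProjectiveDimensionLT_baseChange_quotient hreg n (maximalIdeal R)
    (fun y z hyz => Subtype.ext (hreg (congrArg Subtype.val hyz))) h1
  have hret : Retract (ModuleCat.of (R ⧸ Ideal.span {x}) (ResidueField (R ⧸ Ideal.span {x})))
      (ModuleCat.of (R ⧸ Ideal.span {x}) ((R ⧸ Ideal.span {x}) ⊗[R] maximalIdeal R)) :=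
    ⟨ModuleCat.ofHom a, ModuleCat.ofHom b, by
      ext y
      exact hab y⟩
  exact ⟨n + 1, hret.hasProjectiveDimensionLT (n + 1)⟩

lemma spanFinrank_maximalIdeal_le_succ [IsNoetherianRing R] {x : R} (hx : x ∈ maximalIdeal R)
    [IsLocalRing (R ⧸ Ideal.span {x})] :
    (maximalIdeal R).spanFinrank ≤ (maximalIdeal (R ⧸ Ideal.span {x})).spanFinrank + 1 := by
  classical
  have hsurj : Function.Surjective (Ideal.Quotient.mk (Ideal.span {x})) :=
    Ideal.Quotient.mk_surjective
  have hloc : IsLocalHom (Ideal.Quotient.mk (Ideal.span {x})) := IsLocalHom.of_surjective _ hsurj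
  obtain ⟨s, hcard, hs⟩ :=
    Submodule.FG.exists_span_finset_card_eq_spanFinrank
      (maximalIdeal (R ⧸ Ideal.span {x})).fg_of_isNoetherianRing
  have hmem : ∀ {r : R}, Ideal.Quotient.mk (Ideal.span {x}) r ∈
      maximalIdeal (R ⧸ Ideal.span {x}) ↔ r ∈ maximalIdeal R := by
    intro r
    rw [mem_maximalIdeal, mem_maximalIdeal, mem_nonunits_iff, mem_nonunits_iff, isUnit_map_iff]
  let l := Function.surjInv hsurj
  have hl : ∀ y, Ideal.Quotient.mk (Ideal.span {x}) (l y) = y := Function.surjInv_eq hsurj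
  have hspan : maximalIdeal R = Ideal.span (insert x (s.image l) : Finset R) := by
    apply le_antisymm
    · intro r hr
      have h1 : Ideal.Quotient.mk (Ideal.span {x}) r ∈
          (Ideal.span (s.image l : Set R)).map (Ideal.Quotient.mk (Ideal.span {x})) := by
        rw [Ideal.map_span, Finset.coe_image, Set.image_image]
        simp only [hl, Set.image_id']
        change _ ∈ Submodule.span _ _
        rw [hs]
        exact hmem.mpr hr
      rw [Ideal.mem_map_iff_of_surjective _ hsurj] at h1
      obtain ⟨w, hw, hwr⟩ := h1
      rw [Ideal.Quotient.eq] at hwr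
      rw [Finset.coe_insert, Ideal.span_insert]
      rw [← sub_sub_cancel w r]
      exact sub_mem (Ideal.mem_sup_right hw) (Ideal.mem_sup_left hwr)
    · rw [Ideal.span_le]
      intro r hr
      rw [Finset.mem_coe, Finset.mem_insert, Finset.mem_image] at hr
      obtain rfl | ⟨y, hy, rfl⟩ := hr
      · exact hx
      · have : y ∈ maximalIdeal (R ⧸ Ideal.span {x}) := by
          rw [← hs]
          exact Submodule.subset_span hy
        rwa [SetLike.mem_coe, ← hmem, hl]
  rw [hspan, ← hcard]
  refine (Submodule.spanFinrank_span_le_ncard_of_finite (Finset.finite_toSet _)).trans ?_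
  rw [Set.ncard_coe_finset]
  exact (Finset.card_insert_le _ _).trans (Nat.add_le_add_right Finset.card_image_le 1)

variable [IsNoetherianRing R]

/-- The residue field is not projective, as a free one would be faithful. So Auslander–Buchsbaum
gives t ≥ 1, whence Hom(k, R) = 0. -/
lemma exists_isSMulRegular_mem_maximalIdeal (hk : FinitePd R (ResidueField R))
    (hm : maximalIdeal R ≠ ⊥) : ∃ r ∈ maximalIdeal R, IsSMulRegular R r := by
  classical
  have hann : ∀ {r : R}, r ∈ Module.annihilator R (ResidueField R) ↔ r ∈ maximalIdeal R := by
    intro r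
    refine ⟨fun hr => ?_, fun hr => Module.mem_annihilator.mpr (smul_residueField_eq_zero hr)⟩
    have := Module.mem_annihilator.mp hr 1
    rwa [Algebra.smul_def, mul_one, ResidueField.algebraMap_eq, residue_eq_zero_iff] at this
  have h1 : ¬ HasProjectiveDimensionLT (ModuleCat.of R (ResidueField R)) 1 := by
    intro h1
    have := projective_of_hasProjectiveDimensionLT_one h1
    have : Module.Free R (ResidueField R) := Module.free_of_flat_of_isLocalRing
    refine hm (le_bot_iff.mp fun r hr => ?_)
    rw [← Module.annihilator_eq_bot.mpr (inferInstance : FaithfulSMul R (ResidueField R))]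
    exact hann.mpr hr
  have ht := Nat.find_spec (exists_not_extZero_residueField (R := R))
  have hmin : ∀ i, i < Nat.find (exists_not_extZero_residueField (R := R)) →
      ExtZero R (ResidueField R) R i := fun i hi => not_not.mp (Nat.find_min _ hi)
  have hspec := Nat.find_spec hk
  have hp := fun {m} => Nat.find_min hk (m := m)
  generalize Nat.find hk = p at hspec hp
  obtain hle | ⟨q, rfl⟩ : p ≤ 1 ∨ ∃ q, p = q + 2 := by
    obtain _ | _ | q := p
    · simp
    · simp
    · exact Or.inr ⟨q, rfl⟩
  · exact absurd (hasProjectiveDimensionLT_of_ge _ p _ hle) h1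
  · obtain ⟨hq, -⟩ := not_extZero_of_projectiveDimension hmin ht q _ hspec (hp (by omega))
    have hsub : Subsingleton (ResidueField R →ₗ[R] R) :=
      subsingleton_of_forall_eq 0 (extZero_zero_iff.mp (hmin 0 (by omega)))
    obtain ⟨r, hr, hreg⟩ := IsSMulRegular.subsingleton_linearMap_iff.mp hsub
    exact ⟨r, hann.mp hr, hreg⟩

lemma exists_isSMulRegular_notMem_sq {r : R} (hr : r ∈ maximalIdeal R) (hreg : IsSMulRegular R r)
    (hm : maximalIdeal R ≠ ⊥) :
    ∃ x ∈ maximalIdeal R, x ∉ maximalIdeal R ^ 2 ∧ IsSMulRegular R x := by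
  by_contra! hall
  have hsub : (maximalIdeal R : Set R) ⊆
      ⋃ I ∈ insert (maximalIdeal R ^ 2) (associatedPrimes R R), ((id I : Ideal R) : Set R) := by
    intro y hy
    rw [Set.biUnion_insert]
    by_cases hy2 : y ∈ maximalIdeal R ^ 2
    · exact Or.inl hy2
    · right
      simp only [id]
      rw [biUnion_associatedPrimes_eq_compl_nonZeroDivisors]
      exact fun hy' => hall y hy hy2 (Module.Flat.isSMulRegular_of_nonZeroDivisors hy')
  -- Prime avoidance tolerates two ideals that are not prime; the square of the maximal ideal is
  -- passed as both.
  obtain ⟨I, hI, hle⟩ := (Ideal.subset_union_prime_finite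
    ((associatedPrimes.finite R R).insert _) (maximalIdeal R ^ 2) (maximalIdeal R ^ 2)
    (fun I hI h _ => (hI.resolve_left h).1)).mp hsub
  obtain rfl | hI := hI
  · refine hm (Submodule.eq_bot_of_le_smul_of_le_jacobson_bot (maximalIdeal R) _
      (maximalIdeal R).fg_of_isNoetherianRing ?_ (maximalIdeal_le_jacobson _))
    rwa [smul_eq_mul, ← pow_two]
  · have h1 : r ∈ ⋃ I ∈ associatedPrimes R R, (I : Set R) :=
      Set.mem_biUnion hI (hle hr)
    rw [biUnion_associatedPrimes_eq_compl_nonZeroDivisors] at h1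
    refine h1 (mem_nonZeroDivisors_iff_right.mpr fun z hz => hreg ?_)
    simpa [mul_comm] using hz

/-- A Noetherian local ring whose residue field has finite projective dimension is regular. -/
theorem isRegularLocalRing_of_finitePd_residueField (hk : FinitePd R (ResidueField R)) :
    IsRegularLocalRing R := by
  -- Induction on a bound for dim R + 1, so that n = 0 is vacuous. Passing to R/(x) lowers the
  -- dimension by exactly one and the number of generators of the maximal ideal by at most one.
  have key : ∀ (n : ℕ) (R : Type u) [CommRing R] [IsLocalRing R] [IsNoetherianRing R],
      ringKrullDim R + 1 ≤ n → FinitePd R (ResidueField R) → IsRegularLocalRing R := by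
    intro n
    induction n with
    | zero =>
      intro R _ _ _ hn _
      exact absurd ((ENat.WithBot.add_one_le_zero_iff _).mp hn) ringKrullDim_ne_bot
    | succ n ih =>
      intro R _ _ _ hn hk
      apply IsRegularLocalRing.of_spanFinrank_maximalIdeal_le
      by_cases hm : maximalIdeal R = ⊥
      · rw [hm, Submodule.spanFinrank_bot]
        exact ringKrullDim_nonneg_of_nontrivial
      obtain ⟨r, hr, hrreg⟩ := exists_isSMulRegular_mem_maximalIdeal hk hm
      obtain ⟨x, hx, hx2, hreg⟩ := exists_isSMulRegular_notMem_sq hr hrreg hm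
      have hnt : Nontrivial (R ⧸ Ideal.span {x}) := Ideal.Quotient.nontrivial_iff.mpr
        (ne_top_of_le_ne_top (maximalIdeal.isMaximal R).ne_top
          ((Ideal.span_singleton_le_iff_mem _).mpr hx))
      have hloc : IsLocalRing (R ⧸ Ideal.span {x}) :=
        IsLocalRing.of_surjective' _ Ideal.Quotient.mk_surjective
      have hdim := ringKrullDim_quotient_span_singleton_succ_eq_ringKrullDim hreg hx
      have hn' : ringKrullDim (R ⧸ Ideal.span {x}) + 1 ≤ n := by
        rw [hdim]
        exact ENat.WithBot.add_le_add_one_right_iff.mp (by simpa using hn)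
      have := ih _ hn' (finitePd_residueField_quotient hk hx hx2 hreg)
      rw [← hdim, ← IsRegularLocalRing.spanFinrank_maximalIdeal (R := R ⧸ Ideal.span {x})]
      exact_mod_cast spanFinrank_maximalIdeal_le_succ hx
  obtain ⟨n, hn⟩ : ∃ n : ℕ, ringKrullDim R ≤ n :=
    ⟨_, ringKrullDim_le_spanFinrank_maximalIdeal R⟩
  exact key (n + 1) R (by simpa using ENat.WithBot.add_le_add_one_right_iff.mpr hn) hk

end Serre

theorem mainTheorem10 (R : Type u) [CommRing R] [IsNoetherianRing R] [IsLocalRing R]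
    (C : Type u) [AddCommGroup C] [Module R C] [Module.Finite R C]
    (hC : IsSemidualizing R C)
    (M : Type u) [AddCommGroup M] [Module R M] [Module.Finite R M] [Nontrivial M]
    (hM : IsStronglyRigid R M)
    (h : cProjectiveDimension R C M < ⊤ ∨ cInjectiveDimension R C M < ⊤) :
    IsRegularLocalRing R := by
  obtain ⟨n, hn⟩ : ∃ n, ∀ j, n < j → ExtZero R M M j :=
    h.elim (exists_extZero_self_of_cProjectiveDimension hC)
      (exists_extZero_self_of_cInjectiveDimension hC)
  exact isRegularLocalRing_of_finitePd_residueField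
    (hM.finitePd_of_finitePd (hM.finitePd_self hn) (IsLocalRing.ResidueField R))
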